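/- **Setting.** For $z\in\{1,2\}$, a positive integer $k$ and $\rho_1,\rho_2\in(-1,1)$, let $\Sigma_{\rho_2}^{[k,z]}$ be the $k\times k$ matrix with unit diagonal and off-diagonal entries $\rho_2$ if $z=1$ (equicorrelation), $\rho_2^{|i-j|}$ if $z=2$ (autoregressive), and let $$\Sigma_{\rho_1,\rho_2}^{[k,z]}=\begin{pmatrix}1&\rho_1\mathbf 1_k^{\mathrm T}\\ \rho_1\mathbf 1_k&\Sigma_{\rho_2}^{[k,z]}\end{pmatrix}.$$ If $z=1$ assume $\rho_1^2<\rho_2$; if $z=2$ assume that $\Sigma_{\rho_1,\rho_2}^{[k,2]}$ is positive definite. Let $\mathrm{df}>0$, and let $\Phi_{\mathrm{df}}$ be the distribution function of the Student $t$-distribution with $\mathrm{df}$ degrees of freedom, with $\Phi_{\mathrm{df}}(-\infty)=0$, $\Phi_{\mathrm{df}}(\infty)=1$, and $\phi_{\mathrm{df}}$ its density. For a positive definite $p\times p$ matrix $\Sigma$, the centred multivariate $t$-distribution has density $$t_{\mathrm{df},\Sigma}(x)=\frac{\Gamma\left(\frac{p+\mathrm{df}}2\right)}{\Gamma\left(\frac{\mathrm{df}}2\right)(\pi\,\mathrm{df})^{p/2}|\Sigma|^{1/2}}\left(1+\tfrac1{\mathrm{df}}x^{\mathrm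 T}\Sigma^{-1}x\right)^{-(p+\mathrm{df})/2}$$ on $\mathbb R^p$. The $t$-copula $C_{\mathrm{df},\Sigma}(u_1,\dots,u_p)$ is its joint distribution function at $(\Phi_{\mathrm{df}}^{-1}(u_1),\dots,\Phi_{\mathrm{df}}^{-1}(u_p))$, with density $c_{\mathrm{df},\Sigma}(u)=t_{\mathrm{df},\Sigma}(x)/\prod_i\phi_{\mathrm{df}}(x_i)$, $x_i=\Phi_{\mathrm{df}}^{-1}(u_i)$, on $(0,1)^p$. Let $F_2$ be the distribution function of a probability distribution on $[0,\infty)$ with probability density function $f_2$. Let $N^+$ be a positive integer-valued random variable with distribution function $F_1^+$ and probability mass function $f_1^+$, and let $Y^{[k]}=(Y_1,\dots,Y_k)$ be a random vector such that $(N^+,Y^{[k]})$ has joint distribution function $C_{\mathrm{df},\Sigma_{\rho_1,\rho_2}^{[k,z]}}(F_1^+,F_2,\dots,F_2)$. Put $x=x(y)=(\Phi_{\mathrm{df}}^{-1}(F_2(y_1)),\dots,\Phi_{\mathrm{df}}^{-1}(F_2(y_k)))^{\mathrm T}$ and $$\mu^*(y)=\rho_1\mathbf 1_k^{\mathrm T}\left(\Sigma_{\rho_2}^{[k,z]}\right)^{-1}x,\qquad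 \sigma^*(y)=\sqrt{1-\rho_1^2\,\mathbf 1_k^{\mathrm T}\left(\Sigma_{\rho_2}^{[k,z]}\right)^{-1}\mathbf 1_k}\;\sqrt{\frac{\mathrm{df}+x^{\mathrm T}\left(\Sigma_{\rho_2}^{[k,z]}\right)^{-1}x}{\mathrm{df}+k}},$$ $$f^*_Y(y)=c_{\mathrm{df},\Sigma_{\rho_2}^{[k,z]}}(F_2(y_1),\dots,F_2(y_k))\prod_{i=1}^kf_2(y_i).$$ **Claim.** (i) $(N^+,Y^{[k]})$ has the joint density (with respect to counting measure times Lebesgue measure) $$h(n,y)=f^*_Y(y)\left(\Phi_{\mathrm{df}+k}\left(\frac{\Phi_{\mathrm{df}}^{-1}(F_1^+(n))-\mu^*(y)}{\sigma^*(y)}\right)-\Phi_{\mathrm{df}+k}\left(\frac{\Phi_{\mathrm{df}}^{-1}(F_1^+(n-1))-\mu^*(y)}{\sigma^*(y)}\right)\right),\quad n\ge1,\ y\in\mathbb R^k.$$ Moreover, $Y^{[k]}$ has distribution function $C_{\mathrm{df},\Sigma_{\rho_2}^{[k,z]}}(F_2,\dots,F_2)$, and $f^*_Y$ is its density. (ii)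 For every $n\ge1$ with $f_1^+(n)>0$, the conditional density of $Y^{[k]}$ given $N^+=n$ is $$\frac{f^*_Y(y)}{f_1^+(n)}\left(\Phi_{\mathrm{df}+k}\left(\frac{\Phi_{\mathrm{df}}^{-1}(F_1^+(n))-\mu^*(y)}{\sigma^*(y)}\right)-\Phi_{\mathrm{df}+k}\left(\frac{\Phi_{\mathrm{df}}^{-1}(F_1^+(n-1))-\mu^*(y)}{\sigma^*(y)}\right)\right).$$ -/

import Mathlib

open MeasureTheory ProbabilityTheory Matrix

noncomputable section

namespace CollectiveRisk

/-! ### Correlation matrices -/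

/-- The two correlation structures: equicorrelation (`z = 1`) and autoregressive (`z = 2`). -/
inductive CorrKind
  | equi
  | autoreg

/-- The severity correlation matrix: unit diagonal, with off-diagonal entries `ρ₂`
(equicorrelation) or `ρ₂ ^ |i - j|` (autoregressive). -/
def sevCorr (z : CorrKind) (k : ℕ) (ρ₂ : ℝ) : Matrix (Fin k) (Fin k) ℝ :=
  match z with
  | .equi => Matrix.of fun i j => if i = j then 1 else ρ₂
  | .autoreg => Matrix.of fun i j => if i = j then 1 else ρ₂ ^ ((i : ℤ) - (j : ℤ)).natAbs

/-- The column vector `ρ₁ 1ₖ`. -/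
def crossCorr (k : ℕ) (ρ₁ : ℝ) : Fin k → ℝ := fun _ => ρ₁

/-- The correlation matrix of frequency and severities, in block form
`[[1, ρ₁ 1ᵀ], [ρ₁ 1, sevCorr]]`; the index `Sum.inl ()` is the frequency coordinate. -/
def fullCorr (z : CorrKind) (k : ℕ) (ρ₁ ρ₂ : ℝ) : Matrix (Unit ⊕ Fin k) (Unit ⊕ Fin k) ℝ :=
  Matrix.fromBlocks 1 (Matrix.replicateRow Unit (crossCorr k ρ₁))
    (Matrix.replicateCol Unit (crossCorr k ρ₁)) (sevCorr z k ρ₂)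

/-! ### Student t-distributions -/

/-- Density of the univariate Student t-distribution with `df` degrees of freedom. -/
def tPDF (df x : ℝ) : ℝ :=
  Real.Gamma ((df + 1) / 2) / (Real.Gamma (df / 2) * Real.sqrt (Real.pi * df)) *
    (1 + x ^ 2 / df) ^ (-((df + 1) / 2))

/-- The univariate Student t-distribution. -/
def tMeasure (df : ℝ) : Measure ℝ :=
  volume.withDensity fun x => ENNReal.ofReal (tPDF df x)

/-- The Student t distribution function `Φ_df`, extended to `[-∞, ∞]`
(with values `0` at `-∞` and `1` at `∞`). -/
def tCDF (df : ℝ) (x : EReal) : ℝ :=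
  (tMeasure df).real {t : ℝ | (t : EReal) ≤ x}

/-- The inverse `Φ_df⁻¹ : [0, 1] → [-∞, ∞]`. It takes the values `-∞` at `0`, `∞` at `1`,
and real values on `(0, 1)`. -/
def tQuantile (df u : ℝ) : EReal :=
  sInf {x : EReal | u ≤ tCDF df x}

/-- `Φ_df⁻¹` as a real number (meaningful on `(0, 1)`). -/
def tQuantileReal (df u : ℝ) : ℝ := (tQuantile df u).toReal

/-- Density of the centred multivariate t-distribution with scale matrix `S` and `df` degrees
of freedom. -/
def mvtPDF {ι : Type*} [Fintype ι] [DecidableEq ι] (df : ℝ) (S : Matrix ι ι ℝ) (x : ι → ℝ) : ℝ :=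
  Real.Gamma ((Fintype.card ι + df) / 2) /
      (Real.Gamma (df / 2) * (Real.pi * df) ^ ((Fintype.card ι : ℝ) / 2) * Real.sqrt S.det) *
    (1 + (x ⬝ᵥ (S⁻¹ *ᵥ x)) / df) ^ (-((Fintype.card ι + df) / 2))

/-- The centred multivariate t-distribution. -/
def mvtMeasure {ι : Type*} [Fintype ι] [DecidableEq ι] (df : ℝ) (S : Matrix ι ι ℝ) :
    Measure (ι → ℝ) :=
  volume.withDensity fun x => ENNReal.ofReal (mvtPDF df S x)

/-! ### The t-copula -/

/-- The t-copula: the joint distribution function of the multivariate t-distribution,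
evaluated at the univariate t-quantiles. -/
def tCopula {ι : Type*} [Fintype ι] [DecidableEq ι] (df : ℝ) (S : Matrix ι ι ℝ)
    (u : ι → ℝ) : ℝ :=
  (mvtMeasure df S).real {x | ∀ i, (x i : EReal) ≤ tQuantile df (u i)}

/-- The density of the t-copula (on the open unit cube). -/
def tCopulaDensity {ι : Type*} [Fintype ι] [DecidableEq ι] (df : ℝ) (S : Matrix ι ι ℝ)
    (u : ι → ℝ) : ℝ :=
  mvtPDF df S (fun i => tQuantileReal df (u i)) / ∏ i, tPDF df (tQuantileReal df (u i))

/-! ### Densities and the model -/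

/-- `g` is a density with respect to Lebesgue measure of the measure `ν`. -/
def HasDensity {E : Type*} [MeasureSpace E] (ν : Measure E) (g : E → ℝ) : Prop :=
  Measurable g ∧ (∀ y, 0 ≤ g y) ∧ ν = volume.withDensity fun y => ENNReal.ofReal (g y)

/-- The distribution function `F₁⁺` of the frequency. -/
def freqCDF {Ω : Type*} [MeasurableSpace Ω] (P : Measure Ω) (N : Ω → ℕ) (s : ℝ) : ℝ :=
  P.real {ω | (N ω : ℝ) ≤ s}

/-- The probability mass function `f₁⁺` of the frequency. -/
def freqPMF {Ω : Type*} [MeasurableSpace Ω] (P : Measure Ω) (N : Ω → ℕ) (n : ℕ) : ℝ :=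
  P.real {ω | N ω = n}

/-- The conditional collective risk model with a t-copula: `N` is a positive integer-valued random
variable, `Y = (Y₁, …, Yₖ)` is a random vector, and the joint distribution function of `(N, Y)` is
`C_{df, Σ}(F₁⁺, F₂, …, F₂)`, where `F₁⁺` is the distribution function of `N` and `F₂` is the
distribution function of the severity distribution `ν₂`. -/
structure IsTCopulaModel {Ω : Type*} [MeasurableSpace Ω] (P : Measure Ω) (z : CorrKind) (k : ℕ)
    (df ρ₁ ρ₂ : ℝ) (ν₂ : Measure ℝ) (N : Ω → ℕ) (Y : Ω → Fin k → ℝ) : Prop where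
  measurable_freq : Measurable N
  measurable_sev : Measurable Y
  freq_pos : ∀ ω, 0 < N ω
  joint_cdf : ∀ (s : ℝ) (y : Fin k → ℝ),
    P.real {ω | (N ω : ℝ) ≤ s ∧ ∀ i, Y ω i ≤ y i} =
      tCopula df (fullCorr z k ρ₁ ρ₂)
        (Sum.elim (fun _ => freqCDF P N s) (fun i => cdf ν₂ (y i)))

/-! ### The quantities in the density formula -/

/-- The vector `(Φ_df⁻¹(F₂(y₁)), …, Φ_df⁻¹(F₂(yₖ)))`. -/
def scores {k : ℕ} (df : ℝ) (ν₂ : Measure ℝ) (y : Fin k → ℝ) : Fin k → ℝ :=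
  fun i => tQuantileReal df (cdf ν₂ (y i))

/-- `f*_Y(y) = c_{df, Σ}(F₂(y₁), …, F₂(yₖ)) ∏ f₂(yᵢ)` with `Σ` the severity correlation matrix. -/
def fStar (z : CorrKind) (k : ℕ) (df ρ₂ : ℝ) (ν₂ : Measure ℝ) (f₂ : ℝ → ℝ)
    (y : Fin k → ℝ) : ℝ :=
  tCopulaDensity df (sevCorr z k ρ₂) (fun i => cdf ν₂ (y i)) * ∏ i, f₂ (y i)

/-- The conditional location `μ*`. -/
def muStar (z : CorrKind) (k : ℕ) (df ρ₁ ρ₂ : ℝ) (ν₂ : Measure ℝ) (y : Fin k → ℝ) : ℝ :=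
  crossCorr k ρ₁ ⬝ᵥ ((sevCorr z k ρ₂)⁻¹ *ᵥ scores df ν₂ y)

/-- The Gaussian conditional scale `σ`. -/
def sigma (z : CorrKind) (k : ℕ) (ρ₁ ρ₂ : ℝ) : ℝ :=
  Real.sqrt (1 - crossCorr k ρ₁ ⬝ᵥ ((sevCorr z k ρ₂)⁻¹ *ᵥ crossCorr k ρ₁))

/-- The conditional scale `σ*`. -/
def sigmaStar (z : CorrKind) (k : ℕ) (df ρ₁ ρ₂ : ℝ) (ν₂ : Measure ℝ) (y : Fin k → ℝ) : ℝ :=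
  sigma z k ρ₁ ρ₂ *
    Real.sqrt ((df + scores df ν₂ y ⬝ᵥ ((sevCorr z k ρ₂)⁻¹ *ᵥ scores df ν₂ y)) / (df + k))

/-- `Φ_{df+k}((Φ_df⁻¹(u) - μ*) / σ*)`; the argument of `Φ_{df+k}` is `-∞` for `u = 0` and `∞` for
`u = 1`. -/
def condFreqCDF (z : CorrKind) (k : ℕ) (df ρ₁ ρ₂ : ℝ) (ν₂ : Measure ℝ) (u : ℝ)
    (y : Fin k → ℝ) : ℝ :=
  tCDF (df + k)
    ((tQuantile df u - (muStar z k df ρ₁ ρ₂ ν₂ y : EReal)) /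
      (sigmaStar z k df ρ₁ ρ₂ ν₂ y : EReal))

end CollectiveRisk

end

namespace CollectiveRisk

open Set Filter Topology

/-! The core is the conditioning identity for the multivariate t-distribution (`mvtPDF_bordered`).
With `R` the severity block, `v` its Schur complement, `q` the quadratic form of `R⁻¹` at `y` and
`d` the deviation of the first coordinate from its conditional location, the full determinant is
`|R| v` and the full quadratic form is `q + d² / v`. Then `1 + (q + d² / v) / df` factors as `(1 + q
/ df) (1 + (d / s)² / (df + k))` with `s² = v (df + q) / (df + k)`, so the joint density is the
density for `R` times a Student density with `df + k` degrees of freedom, location `condLoc` and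
scale `s`. Integrating out the first coordinate up to a quantile produces `Φ_{df+k}`.

The remaining coordinates are moved from scores to severities by the probability integral transform
(`setLIntegral_mvtPDF_eq`). Since this transports measures and differentiates nothing, `F₂` may have
flat stretches and `f₂` may vanish or be discontinuous.

Together these express `P(N ≤ s, Y ≤ y)` as the integral over `t ≤ y` of `condFreqCDF` at `F₁⁺(s)`
times `fStar` (`IsTCopulaModel.measure_joint`). Differencing at `s = n` and `s = n - 1` gives the
joint density, letting `s → ∞` gives the law of `Y`, and dividing by `f₁⁺(n)` gives the conditional
density. Lower orthants determine finite measures, which turns these formulas into densities. -/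

/-! ### Student density and its normalisation -/

lemma tPDF_pos {df : ℝ} (hdf : 0 < df) (x : ℝ) : 0 < tPDF df x := by
  have h1 := Real.Gamma_pos_of_pos (show 0 < (df + 1) / 2 by positivity)
  have h2 := Real.Gamma_pos_of_pos (show 0 < df / 2 by positivity)
  have h3 := Real.pi_pos
  unfold tPDF
  positivity

@[fun_prop]
lemma measurable_tPDF (df : ℝ) : Measurable (tPDF df) := by
  unfold tPDF
  fun_prop

lemma lintegral_rpow_mul_exp_neg_mul {s r : ℝ} (hs : 0 < s) (hr : 0 < r) :
    ∫⁻ t in Ioi (0 : ℝ), ENNReal.ofReal (t ^ (s - 1) * Real.exp (-(r * t))) =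
      ENNReal.ofReal (r ^ (-s) * Real.Gamma s) := by
  have key := Real.integral_rpow_mul_exp_neg_mul_Ioi hs hr
  have hG := Real.Gamma_pos_of_pos hs
  -- The Bochner integral of a non-integrable function is `0`, so a nonzero value forces
  -- integrability.
  have hi : IntegrableOn (fun t : ℝ => t ^ (s - 1) * Real.exp (-(r * t))) (Ioi 0) :=
    Integrable.of_integral_ne_zero (by rw [key]; positivity)
  rw [← ofReal_integral_eq_lintegral_ofReal hi, key, one_div, Real.inv_rpow hr.le,
    Real.rpow_neg hr.le]
  filter_upwards [ae_restrict_mem measurableSet_Ioi] with t ht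
  have : (0 : ℝ) < t := ht
  positivity

lemma lintegral_exp_neg_mul_sq {b : ℝ} (hb : 0 < b) :
    ∫⁻ x : ℝ, ENNReal.ofReal (Real.exp (-b * x ^ 2)) = ENNReal.ofReal (√(Real.pi / b)) := by
  rw [← integral_gaussian, ofReal_integral_eq_lintegral_ofReal (integrable_exp_neg_mul_sq hb)]
  exact ae_of_all _ fun x => (Real.exp_pos _).le

/-- The Student kernel integrates to a ratio of Gamma values, by writing it as a Gamma mixture of
Gaussian kernels. -/
lemma lintegral_one_add_sq_div_rpow {df : ℝ} (hdf : 0 < df) :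
    ENNReal.ofReal (Real.Gamma ((df + 1) / 2)) *
      ∫⁻ x : ℝ, ENNReal.ofReal ((1 + x ^ 2 / df) ^ (-((df + 1) / 2))) =
      ENNReal.ofReal (√(Real.pi * df) * Real.Gamma (df / 2)) := by
  set s := (df + 1) / 2 with hs
  have hs0 : 0 < s := by positivity
  have hGs := Real.Gamma_pos_of_pos hs0
  rw [← lintegral_const_mul _ (by fun_prop)]
  have h1 : ∀ x : ℝ, ENNReal.ofReal (Real.Gamma s) * ENNReal.ofReal ((1 + x ^ 2 / df) ^ (-s)) =
      ∫⁻ t in Ioi (0 : ℝ), ENNReal.ofReal (t ^ (s - 1) * Real.exp (-((1 + x ^ 2 / df) * t))) := by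
    intro x
    rw [lintegral_rpow_mul_exp_neg_mul hs0 (by positivity), ← ENNReal.ofReal_mul hGs.le, mul_comm]
  simp_rw [h1]
  rw [lintegral_lintegral_swap (by fun_prop)]
  have h2 : ∀ t ∈ Ioi (0 : ℝ),
      ∫⁻ x : ℝ, ENNReal.ofReal (t ^ (s - 1) * Real.exp (-((1 + x ^ 2 / df) * t))) =
      ENNReal.ofReal (√(Real.pi * df)) *
        ENNReal.ofReal (t ^ (df / 2 - 1) * Real.exp (-(1 * t))) := by
    intro t ht
    have ht : 0 < t := ht
    have h3 : ∀ x : ℝ, ENNReal.ofReal (t ^ (s - 1) * Real.exp (-((1 + x ^ 2 / df) * t))) =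
        ENNReal.ofReal (t ^ (s - 1) * Real.exp (-t)) *
          ENNReal.ofReal (Real.exp (-(t / df) * x ^ 2)) := by
      intro x
      rw [← ENNReal.ofReal_mul (by positivity), mul_assoc, ← Real.exp_add]
      congr 3
      ring_nf
    simp_rw [h3]
    rw [lintegral_const_mul _ (by fun_prop), lintegral_exp_neg_mul_sq (by positivity),
      ← ENNReal.ofReal_mul (by positivity), ← ENNReal.ofReal_mul (by positivity)]
    congr 1
    -- The Gaussian integral contributes `t ^ (-1/2)`, which lowers the Gamma exponent from `(df +
    -- 1) / 2 - 1` to `df / 2 - 1`.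
    have h4 : √(Real.pi / (t / df)) = √(Real.pi * df) * t ^ (-(1 / 2) : ℝ) := by
      rw [Real.rpow_neg ht.le, ← Real.sqrt_eq_rpow, ← Real.sqrt_inv,
        ← Real.sqrt_mul (by positivity)]
      congr 1
      field_simp
    have h5 : t ^ (df / 2 - 1) = t ^ (s - 1) * t ^ (-(1 / 2) : ℝ) := by
      rw [← Real.rpow_add ht]
      congr 1
      rw [hs]
      ring
    rw [h4, h5, one_mul]
    ring
  rw [setLIntegral_congr_fun measurableSet_Ioi h2, lintegral_const_mul _ (by fun_prop),
    lintegral_rpow_mul_exp_neg_mul (by positivity) one_pos, ← ENNReal.ofReal_mul (by positivity),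
    Real.one_rpow, one_mul]

lemma lintegral_tPDF {df : ℝ} (hdf : 0 < df) : ∫⁻ x, ENNReal.ofReal (tPDF df x) = 1 := by
  have h1 := Real.Gamma_pos_of_pos (show 0 < (df + 1) / 2 by positivity)
  have h2 := Real.Gamma_pos_of_pos (show 0 < df / 2 by positivity)
  have h3 := Real.pi_pos
  have h : ∀ x, ENNReal.ofReal (tPDF df x) =
      ENNReal.ofReal ((Real.Gamma (df / 2) * √(Real.pi * df))⁻¹) *
        (ENNReal.ofReal (Real.Gamma ((df + 1) / 2)) *
          ENNReal.ofReal ((1 + x ^ 2 / df) ^ (-((df + 1) / 2)))) := by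
    intro x
    rw [← ENNReal.ofReal_mul h1.le, ← ENNReal.ofReal_mul (by positivity), tPDF]
    congr 1
    field_simp
  simp_rw [h]
  rw [lintegral_const_mul _ (by fun_prop), lintegral_const_mul _ (by fun_prop),
    lintegral_one_add_sq_div_rpow hdf, ← ENNReal.ofReal_mul (by positivity),
    mul_comm √(Real.pi * df), inv_mul_cancel₀ (by positivity), ENNReal.ofReal_one]

lemma isProbabilityMeasure_tMeasure {df : ℝ} (hdf : 0 < df) :
    IsProbabilityMeasure (tMeasure df) :=
  ⟨by rw [tMeasure, withDensity_apply _ .univ, setLIntegral_univ, lintegral_tPDF hdf]⟩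

lemma volume_absolutelyContinuous_tMeasure {df : ℝ} (hdf : 0 < df) :
    volume ≪ tMeasure df :=
  withDensity_absolutelyContinuous' (by fun_prop)
    (ae_of_all _ fun x => (ENNReal.ofReal_pos.2 (tPDF_pos hdf x)).ne')

/-! ### Distribution functions of atomless measures -/

lemma continuous_cdf (μ : Measure ℝ) [IsProbabilityMeasure μ] [NullSingletonClass μ] :
    Continuous (cdf μ) := by
  refine continuous_iff_continuousAt.2 fun x => ?_
  rw [(monotone_cdf μ).continuousAt_iff_leftLim_eq_rightLim, StieltjesFunction.rightLim_eq]
  have h : (cdf μ).measure {x} = 0 := by rw [measure_cdf]; exact measure_singleton x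
  rw [StieltjesFunction.measure_singleton, ENNReal.ofReal_eq_zero] at h
  linarith [(monotone_cdf μ).leftLim_le (le_refl x)]

lemma exists_cdf_eq (μ : Measure ℝ) [IsProbabilityMeasure μ] [NullSingletonClass μ] {u : ℝ}
    (hu : u ∈ Ioo (0 : ℝ) 1) : ∃ x, cdf μ x = u := by
  obtain ⟨a, ha⟩ := ((tendsto_cdf_atBot μ).eventually_lt_const hu.1).exists
  obtain ⟨b, hb⟩ := ((tendsto_cdf_atTop μ).eventually_const_lt hu.2).exists
  obtain ⟨x, -, hx⟩ := mem_range_of_exists_le_of_exists_ge (continuous_cdf μ) ⟨a, ha.le⟩ ⟨b, hb.le⟩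
  exact ⟨x, rfl⟩

/-- The distribution function of a continuous real random variable, evaluated at that variable,
is uniformly distributed. -/
lemma measure_cdf_le (μ : Measure ℝ) [IsProbabilityMeasure μ] [NullSingletonClass μ] {u : ℝ}
    (hu0 : 0 ≤ u) (hu1 : u ≤ 1) : μ {t | cdf μ t ≤ u} = ENNReal.ofReal u := by
  have main : ∀ v ∈ Ioo (0 : ℝ) 1, μ {t | cdf μ t ≤ v} = ENNReal.ofReal v := by
    intro v hv
    obtain ⟨x, hx⟩ := exists_cdf_eq μ hv
    obtain ⟨b, hb⟩ := ((tendsto_cdf_atTop μ).eventually_const_lt hv.2).exists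
    have hbdd : BddAbove {t | cdf μ t ≤ v} :=
      ⟨b, fun t ht => le_of_not_gt fun h => (hb.trans_le (monotone_cdf μ h.le)).not_ge ht⟩
    have hcl : IsClosed {t | cdf μ t ≤ v} := isClosed_le (continuous_cdf μ) continuous_const
    -- The sublevel set is closed and bounded above, hence a half-line ending at its maximum `m`,
    -- and `cdf μ m = v` because the level `v` is attained.
    have hmem := hcl.csSup_mem ⟨x, hx.le⟩ hbdd
    set m := sSup {t | cdf μ t ≤ v}
    have hset : {t | cdf μ t ≤ v} = Iic m := by
      ext t
      exact ⟨fun ht => le_csSup hbdd ht, fun ht => (monotone_cdf μ ht).trans hmem⟩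
    rw [hset, ← ofReal_cdf]
    congr 1
    exact le_antisymm hmem (hx ▸ monotone_cdf μ (le_csSup hbdd hx.le))
  rcases hu1.eq_or_lt with rfl | hu1
  · simp [cdf_le_one]
  rcases hu0.eq_or_lt with rfl | hu0
  · rw [ENNReal.ofReal_zero]
    -- The level `0` need not be attained, so it is approached by levels `δ ≤ ε`; the cap `1 / 2`
    -- keeps `δ` inside `(0, 1)`.
    refine le_antisymm (ENNReal.le_of_forall_pos_le_add fun ε hε _ => ?_) zero_le
    set δ : ℝ := min ε (1 / 2)
    have hδ : δ ∈ Ioo (0 : ℝ) 1 := ⟨by positivity, by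
      have := min_le_right (ε : ℝ) (1 / 2); change min _ _ < _; linarith⟩
    rw [zero_add]
    calc μ {t | cdf μ t ≤ 0} ≤ μ {t | cdf μ t ≤ δ} :=
          measure_mono fun t (ht : cdf μ t ≤ 0) => ht.trans hδ.1.le
      _ = ENNReal.ofReal δ := main δ hδ
      _ ≤ ENNReal.ofReal ε := ENNReal.ofReal_le_ofReal (min_le_left _ _)
      _ = ε := ENNReal.ofReal_coe_nnreal
  · exact main u ⟨hu0, hu1⟩

/-! ### Student distribution function and quantiles on `[-∞, ∞]` -/

instance nullSingletonClass_tMeasure (df : ℝ) : NullSingletonClass (tMeasure df) := by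
  unfold tMeasure; infer_instance

lemma tCDF_coe {df : ℝ} (hdf : 0 < df) (x : ℝ) : tCDF df x = cdf (tMeasure df) x := by
  have := isProbabilityMeasure_tMeasure hdf
  rw [cdf_eq_real, tCDF]
  congr 1
  ext t
  simp

@[simp]
lemma tCDF_bot (df : ℝ) : tCDF df ⊥ = 0 := by
  simp [tCDF]

lemma tCDF_top {df : ℝ} (hdf : 0 < df) : tCDF df ⊤ = 1 := by
  have := isProbabilityMeasure_tMeasure hdf
  simp [tCDF]

lemma tCDF_mono {df : ℝ} (hdf : 0 < df) : Monotone (tCDF df) := by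
  have := isProbabilityMeasure_tMeasure hdf
  exact fun a b h => measureReal_mono fun t ht => le_trans ht h

lemma tCDF_nonneg (df : ℝ) (x : EReal) : 0 ≤ tCDF df x := measureReal_nonneg

lemma tCDF_le_one {df : ℝ} (hdf : 0 < df) (x : EReal) : tCDF df x ≤ 1 :=
  tCDF_top hdf ▸ tCDF_mono hdf le_top

/-- The density is positive, so every nondegenerate interval has mass. Two real points are inserted
between `a` and `b`, which may be infinite. Hence `tCDF` is a bijection from `[-∞, ∞]` onto `[0,
1]`, and the quantile relations below hold without exceptional endpoints. -/
lemma tCDF_strictMono {df : ℝ} (hdf : 0 < df) : StrictMono (tCDF df) := by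
  have := isProbabilityMeasure_tMeasure hdf
  refine (tCDF_mono hdf).strictMono_of_injective ?_
  have key : ∀ a b : EReal, a < b → tCDF df a ≠ tCDF df b := by
    intro a b hab h
    obtain ⟨c, hac, hcb⟩ := EReal.lt_iff_exists_real_btwn.1 hab
    obtain ⟨d, hcd, hdb⟩ := EReal.lt_iff_exists_real_btwn.1 hcb
    have hcd : c < d := EReal.coe_lt_coe_iff.1 hcd
    have h1 : tCDF df c = tCDF df d := le_antisymm (tCDF_mono hdf (EReal.coe_le_coe_iff.2 hcd.le))
      ((tCDF_mono hdf hdb.le).trans (h ▸ tCDF_mono hdf hac.le))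
    rw [tCDF_coe hdf, tCDF_coe hdf] at h1
    have h2 : tMeasure df (Ioc c d) = 0 := by
      rw [← measure_cdf (tMeasure df), StieltjesFunction.measure_Ioc, h1]
      simp
    have h3 := volume_absolutelyContinuous_tMeasure hdf h2
    simp [hcd.not_ge] at h3
  intro a b h
  rcases lt_trichotomy a b with hab | hab | hab
  · exact (key a b hab h).elim
  · exact hab
  · exact (key b a hab h.symm).elim

lemma tQuantile_tCDF {df : ℝ} (hdf : 0 < df) (x : EReal) : tQuantile df (tCDF df x) = x := by
  simp only [tQuantile, (tCDF_strictMono hdf).le_iff_le]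
  exact csInf_Ici

lemma exists_tCDF_eq {df : ℝ} (hdf : 0 < df) {u : ℝ} (hu : u ∈ Icc (0 : ℝ) 1) :
    ∃ x, tCDF df x = u := by
  have := isProbabilityMeasure_tMeasure hdf
  rcases hu.1.eq_or_lt with rfl | h0
  · exact ⟨⊥, tCDF_bot df⟩
  rcases hu.2.eq_or_lt with rfl | h1
  · exact ⟨⊤, tCDF_top hdf⟩
  obtain ⟨x, hx⟩ := exists_cdf_eq (tMeasure df) ⟨h0, h1⟩
  exact ⟨x, by rw [tCDF_coe hdf, hx]⟩

lemma tCDF_tQuantile {df : ℝ} (hdf : 0 < df) {u : ℝ} (hu : u ∈ Icc (0 : ℝ) 1) :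
    tCDF df (tQuantile df u) = u := by
  obtain ⟨x, rfl⟩ := exists_tCDF_eq hdf hu
  rw [tQuantile_tCDF hdf]

lemma tQuantile_le_iff {df : ℝ} (hdf : 0 < df) {u : ℝ} (hu : u ∈ Icc (0 : ℝ) 1) (x : EReal) :
    tQuantile df u ≤ x ↔ u ≤ tCDF df x := by
  rw [← (tCDF_strictMono hdf).le_iff_le, tCDF_tQuantile hdf hu]

lemma le_tQuantile_iff {df : ℝ} (hdf : 0 < df) {u : ℝ} (hu : u ∈ Icc (0 : ℝ) 1) (x : EReal) :
    x ≤ tQuantile df u ↔ tCDF df x ≤ u := by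
  rw [← (tCDF_strictMono hdf).le_iff_le, tCDF_tQuantile hdf hu]

lemma tQuantile_mono (df : ℝ) : Monotone (tQuantile df) :=
  fun _ _ h => sInf_le_sInf fun _ hx => h.trans hx

@[fun_prop]
lemma measurable_tQuantileReal (df : ℝ) : Measurable (tQuantileReal df) :=
  (tQuantile_mono df).measurable.ereal_toReal

lemma tCDF_tQuantileReal {df : ℝ} (hdf : 0 < df) {u : ℝ} (hu : u ∈ Ioo (0 : ℝ) 1) :
    tCDF df (tQuantileReal df u) = u := by
  have := isProbabilityMeasure_tMeasure hdf
  obtain ⟨x, rfl⟩ := exists_cdf_eq (tMeasure df) hu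
  rw [tQuantileReal, ← tCDF_coe hdf, tQuantile_tCDF hdf, EReal.toReal_coe]

/-! ### Probability integral transform -/

section ProbabilityIntegralTransform

variable (ν : Measure ℝ) [IsProbabilityMeasure ν] [NullSingletonClass ν]

/-- Excludes the levels `0` and `1`, where the quantile is infinite and `tQuantileReal` takes the
default value `0`. -/
lemma ae_cdf_mem_Ioo : ∀ᵐ t ∂ν, cdf ν t ∈ Ioo (0 : ℝ) 1 := by
  have h0 : ν {t | cdf ν t ≤ 0} = 0 := by simpa using measure_cdf_le ν le_rfl zero_le_one
  have h1 : ν {t | 1 ≤ cdf ν t} = 0 := by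
    refine le_antisymm (ENNReal.le_of_forall_pos_le_add fun ε hε _ => ?_) zero_le
    set δ : ℝ := min ε (1 / 2)
    have hδ0 : 0 < δ := by positivity
    have hδ1 : δ ≤ 1 / 2 := min_le_right _ _
    have hm : MeasurableSet {t | cdf ν t ≤ 1 - δ} :=
      measurableSet_le (monotone_cdf ν).measurable measurable_const
    calc ν {t | 1 ≤ cdf ν t} ≤ ν {t | cdf ν t ≤ 1 - δ}ᶜ := by
          refine measure_mono fun t (ht : 1 ≤ cdf ν t) => ?_
          simp only [mem_compl_iff, mem_ofPred_eq, not_le]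
          linarith
      _ = ENNReal.ofReal δ := by
          rw [prob_compl_eq_one_sub hm, measure_cdf_le ν (by linarith) (by linarith),
            ← ENNReal.ofReal_one, ← ENNReal.ofReal_sub _ (by linarith)]
          congr 1
          ring
      _ ≤ ENNReal.ofReal ε := ENNReal.ofReal_le_ofReal (min_le_left _ _)
      _ = 0 + ε := by rw [ENNReal.ofReal_coe_nnreal, zero_add]
  filter_upwards [measure_eq_zero_iff_ae_notMem.1 h0, measure_eq_zero_iff_ae_notMem.1 h1] with t h h'
  exact ⟨not_le.1 h, not_le.1 h'⟩

lemma ae_tQuantile_eq_coe {df : ℝ} (hdf : 0 < df) :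
    ∀ᵐ t ∂ν, tQuantile df (cdf ν t) = (tQuantileReal df (cdf ν t) : EReal) := by
  filter_upwards [ae_cdf_mem_Ioo ν] with t ht
  refine (tCDF_strictMono hdf).injective ?_
  rw [tCDF_tQuantileReal hdf ht, tCDF_tQuantile hdf (Ioo_subset_Icc_self ht)]

/-- Transforming a continuous random variable by its own distribution function and a Student
quantile function gives a Student random variable. -/
lemma map_tQuantileReal_cdf {df : ℝ} (hdf : 0 < df) :
    ν.map (fun t => tQuantileReal df (cdf ν t)) = tMeasure df := by
  have := isProbabilityMeasure_tMeasure hdf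
  have hm : Measurable fun t => tQuantileReal df (cdf ν t) :=
    (measurable_tQuantileReal df).comp (monotone_cdf ν).measurable
  have := Measure.isProbabilityMeasure_map (μ := ν) hm.aemeasurable
  refine Measure.ext_of_Iic _ _ fun a => ?_
  rw [Measure.map_apply hm measurableSet_Iic, ← ofReal_cdf (tMeasure df), ← tCDF_coe hdf,
    ← measure_cdf_le ν (tCDF_nonneg _ _) (tCDF_le_one hdf _)]
  refine measure_congr ?_
  filter_upwards [ae_cdf_mem_Ioo ν, ae_tQuantile_eq_coe ν hdf] with t ht h
  refine propext ?_
  change tQuantileReal df (cdf ν t) ≤ a ↔ cdf ν t ≤ tCDF df a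
  rw [← tQuantile_le_iff hdf (Ioo_subset_Icc_self ht), h, EReal.coe_le_coe_iff]

/-- Almost surely, the score of `t` is below the quantile of `F(y)` exactly if `t ≤ y`. -/
lemma ae_tQuantileReal_cdf_le_iff {df : ℝ} (hdf : 0 < df) (y : ℝ) :
    ∀ᵐ t ∂ν, ((tQuantileReal df (cdf ν t) : EReal) ≤ tQuantile df (cdf ν y) ↔ t ≤ y) := by
  have hy : cdf ν y ∈ Icc (0 : ℝ) 1 := ⟨cdf_nonneg ν y, cdf_le_one ν y⟩
  -- The half-line lies in the sublevel set and both have mass `F(y)`; they differ only where `F` is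
  -- flat to the right of `y`.
  have h : Iic y =ᵐ[ν] {t | cdf ν t ≤ cdf ν y} := by
    refine ae_eq_of_subset_of_measure_ge (fun t ht => monotone_cdf ν ht) ?_
      measurableSet_Iic.nullMeasurableSet (measure_ne_top _ _)
    rw [measure_cdf_le ν hy.1 hy.2, ofReal_cdf]
  filter_upwards [ae_cdf_mem_Ioo ν, ae_tQuantile_eq_coe ν hdf, h.mem_iff] with t ht hq hm
  rw [← hq, le_tQuantile_iff hdf hy, tCDF_tQuantile hdf (Ioo_subset_Icc_self ht)]
  exact hm.symm

end ProbabilityIntegralTransform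

/-! ### Densities of finite product measures -/

section PiDensity

lemma lintegral_fin_prod_eq_prod {n : ℕ} {E : Fin n → Type*} {mE : ∀ i, MeasurableSpace (E i)}
    {μ : (i : Fin n) → Measure (E i)} [∀ i, SigmaFinite (μ i)]
    {f : (i : Fin n) → E i → ENNReal} (hf : ∀ i, Measurable (f i)) :
    ∫⁻ x : (i : Fin n) → E i, ∏ i, f i (x i) ∂(Measure.pi μ) = ∏ i, ∫⁻ x, f i x ∂(μ i) := by
  induction n with
  | zero => simp
  | succ n ih =>
    have h : Measurable fun x : (i : Fin n) → E i.succ => ∏ i : Fin n, f i.succ (x i) :=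
      Finset.measurable_prod _ fun i _ => (hf _).comp (measurable_pi_apply i)
    rw [Fin.prod_univ_succ, ← ih fun i => hf i.succ,
      ← lintegral_prod_mul (hf 0).aemeasurable h.aemeasurable,
      ← ((measurePreserving_piFinSuccAbove μ 0).symm).lintegral_comp_emb
        (MeasurableEquiv.measurableEmbedding _)]
    refine lintegral_congr fun x => ?_
    rw [Fin.prod_univ_succ]
    rfl

lemma pi_withDensity {n : ℕ} {E : Fin n → Type*} {mE : ∀ i, MeasurableSpace (E i)}
    {μ : (i : Fin n) → Measure (E i)} [∀ i, SigmaFinite (μ i)]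
    {f : (i : Fin n) → E i → ENNReal} (hf : ∀ i, Measurable (f i))
    [∀ i, SigmaFinite ((μ i).withDensity (f i))] :
    Measure.pi (fun i => (μ i).withDensity (f i)) =
      (Measure.pi μ).withDensity fun x => ∏ i, f i (x i) := by
  refine Measure.pi_eq fun s hs => ?_
  rw [withDensity_apply _ (MeasurableSet.univ_pi hs), Measure.restrict_pi_pi,
    lintegral_fin_prod_eq_prod hf]
  exact Finset.prod_congr rfl fun i _ => (withDensity_apply _ (hs i)).symm

end PiDensity

/-! ### Multivariate t density: positivity and finite mass -/

section Multivariate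

/-- The form attains a positive minimum on the compact unit sphere, and homogeneity of degree two
extends the bound. An empty sphere means that the space is trivial. -/
lemma exists_mul_norm_sq_le_quadForm {ι : Type*} [Fintype ι] {A : Matrix ι ι ℝ} (hA : A.PosDef) :
    ∃ c > 0, ∀ x : ι → ℝ, c * ‖x‖ ^ 2 ≤ x ⬝ᵥ (A *ᵥ x) := by
  have hc : Continuous fun x : ι → ℝ => x ⬝ᵥ (A *ᵥ x) :=
    Continuous.dotProduct continuous_id (Continuous.matrix_mulVec continuous_const continuous_id)
  have hpos : ∀ x : ι → ℝ, x ≠ 0 → 0 < x ⬝ᵥ (A *ᵥ x) := fun x hx => by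
    simpa using hA.dotProduct_mulVec_pos hx
  rcases (Metric.sphere (0 : ι → ℝ) 1).eq_empty_or_nonempty with he | hne
  · refine ⟨1, one_pos, fun x => ?_⟩
    have hx : x = 0 := by
      by_contra hx
      have hmem : ‖x‖⁻¹ • x ∈ Metric.sphere (0 : ι → ℝ) 1 := by
        simp [norm_smul, hx]
      rw [he] at hmem
      exact hmem
    simp [hx]
  · obtain ⟨v, hv, hmin⟩ := (isCompact_sphere (0 : ι → ℝ) 1).exists_isMinOn hne hc.continuousOn
    have hv0 : v ≠ 0 := by
      rintro rfl
      simp at hv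
    refine ⟨_, hpos v hv0, fun x => ?_⟩
    rcases eq_or_ne x 0 with rfl | hx
    · simp
    have hmem : ‖x‖⁻¹ • x ∈ Metric.sphere (0 : ι → ℝ) 1 := by
      simp [norm_smul, hx]
    have h := hmin hmem
    simp only [mem_ofPred_eq, mulVec_smul, dotProduct_smul, smul_dotProduct, smul_eq_mul] at h
    have hn : 0 < ‖x‖ := norm_pos_iff.2 hx
    calc v ⬝ᵥ (A *ᵥ v) * ‖x‖ ^ 2
        ≤ (‖x‖⁻¹ * (‖x‖⁻¹ * (x ⬝ᵥ (A *ᵥ x)))) * ‖x‖ ^ 2 := by gcongr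
      _ = x ⬝ᵥ (A *ᵥ x) := by field_simp

variable {ι : Type*} [Fintype ι] [DecidableEq ι]

@[fun_prop]
lemma measurable_mvtPDF (df : ℝ) (S : Matrix ι ι ℝ) : Measurable (mvtPDF df S) := by
  have h : Measurable fun x : ι → ℝ => x ⬝ᵥ (S⁻¹ *ᵥ x) :=
    (Continuous.dotProduct continuous_id
      (Continuous.matrix_mulVec continuous_const continuous_id)).measurable
  unfold mvtPDF
  fun_prop

lemma quadForm_nonneg {S : Matrix ι ι ℝ} (hS : S.PosDef) (x : ι → ℝ) :
    0 ≤ x ⬝ᵥ (S⁻¹ *ᵥ x) := by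
  simpa using hS.inv.posSemidef.dotProduct_mulVec_nonneg x

lemma mvtPDF_pos {df : ℝ} (hdf : 0 < df) {S : Matrix ι ι ℝ} (hS : S.PosDef) (x : ι → ℝ) :
    0 < mvtPDF df S x := by
  have h1 := Real.Gamma_pos_of_pos (show 0 < (Fintype.card ι + df) / 2 by positivity)
  have h2 := Real.Gamma_pos_of_pos (show 0 < df / 2 by positivity)
  have h3 := Real.pi_pos
  have h4 := quadForm_nonneg hS x
  have h5 := hS.det_pos
  unfold mvtPDF
  positivity

/-- The density is dominated by a multiple of `(1 + ‖x‖²) ^ (-(p + df) / 2)`, integrable in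
dimension `p` since `p + df > p`. Finiteness lets identities between real-valued masses be lifted to
`ENNReal`; total mass one is not needed. -/
lemma isFiniteMeasure_mvtMeasure {df : ℝ} (hdf : 0 < df) {S : Matrix ι ι ℝ} (hS : S.PosDef) :
    IsFiniteMeasure (mvtMeasure df S) := by
  obtain ⟨c, hc, hle⟩ := exists_mul_norm_sq_le_quadForm hS.inv
  set r : ℝ := Fintype.card ι + df with hr
  have hr0 : 0 < r := by positivity
  -- Chosen so that `m (1 + ‖x‖²) ≤ 1 + q / df`, where `q` is the quadratic form at `x`.
  set m : ℝ := min (c / df) 1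
  have hm : 0 < m := lt_min (by positivity) one_pos
  have hint : Integrable (fun x : ι → ℝ => ((1 : ℝ) + ‖x‖ ^ 2) ^ (-r / 2)) volume :=
    integrable_rpow_neg_one_add_norm_sq (by simp [hr, hdf])
  have hint2 : Integrable (mvtPDF df S) volume := by
    set K := Real.Gamma ((Fintype.card ι + df) / 2) /
      (Real.Gamma (df / 2) * (Real.pi * df) ^ ((Fintype.card ι : ℝ) / 2) * Real.sqrt S.det) with hK
    have hK0 : 0 ≤ K := by
      have h1 := Real.Gamma_pos_of_pos (show 0 < (Fintype.card ι + df) / 2 by positivity)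
      have h2 := Real.Gamma_pos_of_pos (show 0 < df / 2 by positivity)
      have h3 := Real.pi_pos
      positivity
    refine (hint.const_mul (K * m ^ (-r / 2))).mono' (by fun_prop) (ae_of_all _ fun x => ?_)
    rw [Real.norm_of_nonneg (mvtPDF_pos hdf hS x).le, mvtPDF, ← hK, mul_assoc,
      ← Real.mul_rpow hm.le (by positivity), ← hr, neg_div]
    refine mul_le_mul_of_nonneg_left ?_ hK0
    refine Real.rpow_le_rpow_of_nonpos (by positivity) ?_ (by linarith)
    have h1 : m * ‖x‖ ^ 2 ≤ (x ⬝ᵥ (S⁻¹ *ᵥ x)) / df := by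
      calc m * ‖x‖ ^ 2 ≤ c / df * ‖x‖ ^ 2 := by gcongr; exact min_le_left _ _
        _ = c * ‖x‖ ^ 2 / df := by ring
        _ ≤ _ := by gcongr; exact hle x
    have h2 : m ≤ 1 := min_le_right _ _
    linarith
  exact isFiniteMeasure_withDensity_ofReal hint2.2

end Multivariate

/-! ### Change of variables from scores to severities -/

section Transfer

variable {k : ℕ} {df : ℝ} {ν₂ : Measure ℝ} [IsProbabilityMeasure ν₂] {f₂ : ℝ → ℝ}

@[fun_prop]
lemma measurable_scores (df : ℝ) (ν₂ : Measure ℝ) :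
    Measurable (scores df ν₂ : (Fin k → ℝ) → Fin k → ℝ) := by
  refine measurable_pi_lambda _ fun i => ?_
  exact (measurable_tQuantileReal df).comp
    ((monotone_cdf ν₂).measurable.comp (measurable_pi_apply i))

lemma HasDensity.nullSingletonClass {ν : Measure ℝ} {f : ℝ → ℝ} (hf : HasDensity ν f) :
    NullSingletonClass ν := by
  rw [hf.2.2]
  infer_instance

lemma HasDensity.pi_eq_withDensity (hf₂ : HasDensity ν₂ f₂) :
    Measure.pi (fun _ : Fin k => ν₂) =
      volume.withDensity fun y => ENNReal.ofReal (∏ i, f₂ (y i)) := by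
  have := hf₂.2.2 ▸ (inferInstance : IsProbabilityMeasure ν₂)
  have h := pi_withDensity (μ := fun _ : Fin k => (volume : Measure ℝ))
    (f := fun _ x => ENNReal.ofReal (f₂ x)) fun _ => hf₂.1.ennreal_ofReal
  rw [hf₂.2.2, h, volume_pi]
  simp_rw [ENNReal.ofReal_prod_of_nonneg fun i _ => hf₂.2.1 _]

lemma pi_tMeasure_eq_withDensity (hdf : 0 < df) :
    Measure.pi (fun _ : Fin k => tMeasure df) =
      volume.withDensity fun x => ENNReal.ofReal (∏ i, tPDF df (x i)) := by
  have := isProbabilityMeasure_tMeasure hdf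
  exact HasDensity.pi_eq_withDensity
    ⟨measurable_tPDF df, fun x => (tPDF_pos hdf x).le, rfl⟩

lemma measurePreserving_scores (hdf : 0 < df) (hf₂ : HasDensity ν₂ f₂) :
    MeasurePreserving (scores df ν₂) (Measure.pi fun _ : Fin k => ν₂)
      (Measure.pi fun _ : Fin k => tMeasure df) := by
  have := isProbabilityMeasure_tMeasure hdf
  have := hf₂.nullSingletonClass
  exact measurePreserving_pi _ _ fun _ =>
    ⟨(measurable_tQuantileReal df).comp (monotone_cdf ν₂).measurable,
      map_tQuantileReal_cdf ν₂ hdf⟩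

@[fun_prop]
lemma measurable_tCopulaDensity_cdf (df : ℝ) (ν₂ : Measure ℝ) (R : Matrix (Fin k) (Fin k) ℝ) :
    Measurable fun y : Fin k → ℝ => tCopulaDensity df R fun i => cdf ν₂ (y i) := by
  refine ((measurable_mvtPDF df R).comp (measurable_scores df ν₂)).div
    (Finset.measurable_prod _ fun i _ => (measurable_tPDF df).comp
      ((measurable_pi_apply i).comp (measurable_scores df ν₂)))

/-- Change of variables from scores to severities, over a lower orthant. -/
lemma setLIntegral_mvtPDF_eq (hdf : 0 < df) (hf₂ : HasDensity ν₂ f₂)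
    (R : Matrix (Fin k) (Fin k) ℝ) {H : (Fin k → ℝ) → ENNReal} (hH : Measurable H)
    (y : Fin k → ℝ) :
    ∫⁻ x in {x : Fin k → ℝ | ∀ i, (x i : EReal) ≤ tQuantile df (cdf ν₂ (y i))},
        H x * ENNReal.ofReal (mvtPDF df R x) =
      ∫⁻ t in Iic y, H (scores df ν₂ t) *
        ENNReal.ofReal (tCopulaDensity df R (fun i => cdf ν₂ (t i)) * ∏ i, f₂ (t i)) := by
  have := hf₂.nullSingletonClass
  set A := {x : Fin k → ℝ | ∀ i, (x i : EReal) ≤ tQuantile df (cdf ν₂ (y i))} with hA_def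
  have hA : MeasurableSet A := by
    rw [hA_def, ofPred_forall]
    exact MeasurableSet.iInter fun i => measurableSet_le (by fun_prop) (by fun_prop)
  have hφ : ∀ x : Fin k → ℝ, 0 < ∏ i, tPDF df (x i) := fun x =>
    Finset.prod_pos fun i _ => tPDF_pos hdf _
  -- Dividing by the positive product of Student densities turns Lebesgue measure into the product
  -- Student measure, the image of the severity product measure under `scores`; the quotient is the
  -- copula density.
  set G : (Fin k → ℝ) → ENNReal := A.indicator fun x =>
    H x * ENNReal.ofReal (mvtPDF df R x / ∏ i, tPDF df (x i)) with hG_def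
  have hG : Measurable G := by
    refine Measurable.indicator ?_ hA
    fun_prop
  calc ∫⁻ x in A, H x * ENNReal.ofReal (mvtPDF df R x)
      = ∫⁻ x, ENNReal.ofReal (∏ i, tPDF df (x i)) * G x := by
        rw [← lintegral_indicator hA]
        refine lintegral_congr fun x => ?_
        by_cases hx : x ∈ A
        · simp only [hG_def, indicator_of_mem hx]
          rw [mul_left_comm, ← ENNReal.ofReal_mul (hφ x).le, mul_div_cancel₀ _ (hφ x).ne']
        · simp [hG_def, indicator_of_notMem hx]
    _ = ∫⁻ x, G x ∂Measure.pi fun _ : Fin k => tMeasure df := by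
        rw [pi_tMeasure_eq_withDensity hdf, lintegral_withDensity_eq_lintegral_mul _ _ hG]
        · rfl
        · fun_prop
    _ = ∫⁻ t, G (scores df ν₂ t) ∂Measure.pi fun _ : Fin k => ν₂ :=
        ((measurePreserving_scores hdf hf₂).lintegral_comp hG).symm
    _ = ∫⁻ t in Iic y, H (scores df ν₂ t) *
          ENNReal.ofReal (tCopulaDensity df R fun i => cdf ν₂ (t i))
          ∂Measure.pi fun _ : Fin k => ν₂ := by
        rw [← lintegral_indicator measurableSet_Iic]
        have hae : ∀ᵐ t ∂Measure.pi fun _ : Fin k => ν₂, ∀ i,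
            ((tQuantileReal df (cdf ν₂ (t i)) : EReal) ≤ tQuantile df (cdf ν₂ (y i)) ↔
              t i ≤ y i) :=
          ae_all_iff.2 fun i =>
            (Measure.tendsto_eval_ae_ae (μ := fun _ : Fin k => ν₂) (i := i)).eventually
              (ae_tQuantileReal_cdf_le_iff ν₂ hdf (y i))
        refine lintegral_congr_ae ?_
        filter_upwards [hae] with t ht
        have hiff : scores df ν₂ t ∈ A ↔ t ∈ Iic y := forall_congr' ht
        by_cases h : t ∈ Iic y
        · rw [hG_def, indicator_of_mem (hiff.2 h), indicator_of_mem h]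
          rfl
        · rw [hG_def, indicator_of_notMem (fun h' => h (hiff.1 h')), indicator_of_notMem h]
    _ = _ := by
        have hm : Measurable fun t : Fin k → ℝ => H (scores df ν₂ t) *
            ENNReal.ofReal (tCopulaDensity df R fun i => cdf ν₂ (t i)) := by fun_prop
        have hf : Measurable f₂ := hf₂.1
        rw [hf₂.pi_eq_withDensity, restrict_withDensity measurableSet_Iic,
          lintegral_withDensity_eq_lintegral_mul _ (by fun_prop) hm]
        refine lintegral_congr fun t => ?_
        rw [Pi.mul_apply, mul_left_comm,
          ← ENNReal.ofReal_mul (Finset.prod_nonneg fun i _ => hf₂.2.1 _), mul_comm (∏ i, f₂ (t i))]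

end Transfer

/-! ### Conditioning in a bordered t-distribution -/

section Block

variable {k : ℕ}

/-- The scale matrix of a standardized coordinate and a vector with scale matrix `R`, with
cross-correlations `c`. -/
abbrev bordered (c : Fin k → ℝ) (R : Matrix (Fin k) (Fin k) ℝ) :
    Matrix (Unit ⊕ Fin k) (Unit ⊕ Fin k) ℝ :=
  Matrix.fromBlocks 1 (Matrix.replicateRow Unit c) (Matrix.replicateCol Unit c) R

/-- Location of the first coordinate given the others. -/
noncomputable def condLoc (c : Fin k → ℝ) (R : Matrix (Fin k) (Fin k) ℝ) (y : Fin k → ℝ) : ℝ :=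
  c ⬝ᵥ (R⁻¹ *ᵥ y)

/-- Schur complement of the lower right block of the bordered matrix. -/
noncomputable def condVar (c : Fin k → ℝ) (R : Matrix (Fin k) (Fin k) ℝ) : ℝ :=
  1 - c ⬝ᵥ (R⁻¹ *ᵥ c)

/-- Scale of the first coordinate given the others. -/
noncomputable def condScale (df : ℝ) (c : Fin k → ℝ) (R : Matrix (Fin k) (Fin k) ℝ) (y : Fin k → ℝ) : ℝ :=
  √(condVar c R) * √((df + y ⬝ᵥ (R⁻¹ *ᵥ y)) / (df + k))

variable {c : Fin k → ℝ} {R : Matrix (Fin k) (Fin k) ℝ}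

@[fun_prop]
lemma measurable_condLoc (c : Fin k → ℝ) (R : Matrix (Fin k) (Fin k) ℝ) :
    Measurable (condLoc c R) :=
  (Continuous.dotProduct continuous_const
    (Continuous.matrix_mulVec continuous_const continuous_id)).measurable

@[fun_prop]
lemma measurable_condScale (df : ℝ) (c : Fin k → ℝ) (R : Matrix (Fin k) (Fin k) ℝ) :
    Measurable (condScale df c R) := by
  have h : Measurable fun x : Fin k → ℝ => x ⬝ᵥ (R⁻¹ *ᵥ x) :=
    (Continuous.dotProduct continuous_id
      (Continuous.matrix_mulVec continuous_const continuous_id)).measurable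
  unfold condScale
  fun_prop

lemma posDef_of_bordered (hS : (bordered c R).PosDef) : R.PosDef :=
  hS.submatrix Sum.inr_injective

/-- The Schur complement is the value of the full quadratic form at the nonzero vector `(1, -R⁻¹
c)`. -/
lemma condVar_pos (hS : (bordered c R).PosDef) : 0 < condVar c R := by
  have hdet : IsUnit R.det := (posDef_of_bordered hS).det_pos.ne'.isUnit
  have hne : (Sum.elim (fun _ => 1) (-(R⁻¹ *ᵥ c)) : Unit ⊕ Fin k → ℝ) ≠ 0 := fun h => by
    simpa using congrFun h (Sum.inl ())
  have h := hS.dotProduct_mulVec_pos hne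
  have h1 : bordered c R *ᵥ Sum.elim (fun _ => 1) (-(R⁻¹ *ᵥ c)) =
      Sum.elim (fun _ => condVar c R) 0 := by
    rw [fromBlocks_mulVec]
    congr 1
    · ext i
      simp [condVar, mulVec, dotProduct, sub_eq_add_neg]
    · rw [Sum.elim_comp_inl, Sum.elim_comp_inr, mulVec_neg, mulVec_mulVec, mul_nonsing_inv _ hdet,
        one_mulVec]
      ext i
      simp [mulVec, dotProduct]
  rw [h1] at h
  simpa [dotProduct] using h

lemma condScale_pos {df : ℝ} (hdf : 0 < df) (hS : (bordered c R).PosDef) (y : Fin k → ℝ) :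
    0 < condScale df c R y := by
  have h1 := condVar_pos hS
  have h2 := quadForm_nonneg (posDef_of_bordered hS) y
  unfold condScale
  positivity

lemma quadForm_bordered (hS : (bordered c R).PosDef) (x₀ : ℝ) (y : Fin k → ℝ) :
    (Sum.elim (fun _ => x₀) y : Unit ⊕ Fin k → ℝ) ⬝ᵥ
        ((bordered c R)⁻¹ *ᵥ Sum.elim (fun _ => x₀) y) =
      y ⬝ᵥ (R⁻¹ *ᵥ y) + (x₀ - condLoc c R y) ^ 2 / condVar c R := by
  have hdet : IsUnit R.det := (posDef_of_bordered hS).det_pos.ne'.isUnit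
  have hdetS : IsUnit (bordered c R).det := hS.det_pos.ne'.isUnit
  have hv := condVar_pos hS
  have hsymm : y ⬝ᵥ (R⁻¹ *ᵥ c) = condLoc c R y := by
    rw [condLoc, dotProduct_mulVec, dotProduct_comm, ← mulVec_transpose]
    have : R⁻¹ᵀ = R⁻¹ := by simpa using (posDef_of_bordered hS).inv.isHermitian.eq
    rw [this]
  -- First coordinate of the solution `w` of `bordered c R *ᵥ w = (x₀, y)`; the lower block then
  -- forces the rest to be `R⁻¹ y - w₀ R⁻¹ c`.
  set w₀ := (x₀ - condLoc c R y) / condVar c R with hw₀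
  have h1 : (bordered c R) *ᵥ Sum.elim (fun _ => w₀) (R⁻¹ *ᵥ y - w₀ • (R⁻¹ *ᵥ c)) =
      Sum.elim (fun _ => x₀) y := by
    rw [fromBlocks_mulVec, Sum.elim_comp_inl, Sum.elim_comp_inr]
    congr 1
    · ext i
      have h2 : (replicateRow Unit c *ᵥ (R⁻¹ *ᵥ y - w₀ • (R⁻¹ *ᵥ c))) i =
          condLoc c R y - w₀ * (1 - condVar c R) := by
        change c ⬝ᵥ _ = _
        rw [dotProduct_sub, dotProduct_smul, condLoc, condVar, smul_eq_mul]
        ring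
      rw [Pi.add_apply, h2, one_mulVec, hw₀]
      field_simp
      ring
    · rw [mulVec_sub, mulVec_smul, mulVec_mulVec, mulVec_mulVec, mul_nonsing_inv _ hdet,
        one_mulVec, one_mulVec]
      ext i
      simp [mulVec, dotProduct, mul_comm]
  have h3 : (bordered c R)⁻¹ *ᵥ Sum.elim (fun _ => x₀) y =
      Sum.elim (fun _ => w₀) (R⁻¹ *ᵥ y - w₀ • (R⁻¹ *ᵥ c)) := by
    rw [← h1, mulVec_mulVec, nonsing_inv_mul _ hdetS, one_mulVec]
  rw [h3, sumElim_dotProduct_sumElim, dotProduct_sub, dotProduct_smul, hsymm]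
  simp only [dotProduct, Finset.univ_unique, Finset.sum_singleton, smul_eq_mul]
  rw [hw₀]
  ring

lemma det_bordered (hS : (bordered c R).PosDef) :
    (bordered c R).det = R.det * condVar c R := by
  have hdet : IsUnit R.det := (posDef_of_bordered hS).det_pos.ne'.isUnit
  let := R.invertibleOfIsUnitDet hdet
  rw [det_fromBlocks₂₂, invOf_eq_nonsing_inv, det_unique (n := Unit), condVar, Matrix.sub_apply,
    Matrix.mul_assoc]
  rfl

/-- The density of a multivariate t-distribution is the product of the marginal density and a
shifted and rescaled Student density with more degrees of freedom. -/
lemma mvtPDF_bordered {df : ℝ} (hdf : 0 < df) (hS : (bordered c R).PosDef) (x₀ : ℝ)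
    (y : Fin k → ℝ) :
    mvtPDF df (bordered c R) (Sum.elim (fun _ => x₀) y) =
      mvtPDF df R y *
        ((condScale df c R y)⁻¹ *
          tPDF (df + k) ((x₀ - condLoc c R y) / condScale df c R y)) := by
  have hv := condVar_pos hS
  have hR := (posDef_of_bordered hS).det_pos
  have hs := condScale_pos hdf hS y
  have hq := quadForm_nonneg (posDef_of_bordered hS) y
  have hpi := Real.pi_pos
  set q := y ⬝ᵥ (R⁻¹ *ᵥ y) with hq_def
  set v := condVar c R with hv_def
  set s := condScale df c R y with hs_def
  have hs2 : s ^ 2 = v * ((df + q) / (df + k)) := by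
    rw [hs_def, condScale, mul_pow, Real.sq_sqrt hv.le, Real.sq_sqrt (by positivity)]
  have hG1 := Real.Gamma_pos_of_pos (show 0 < (k + df) / 2 by positivity)
  have hG2 := Real.Gamma_pos_of_pos (show 0 < df / 2 by positivity)
  have hG3 := Real.Gamma_pos_of_pos (show 0 < (df + k + 1) / 2 by positivity)
  set d := x₀ - condLoc c R y
  have hbase : 1 + (q + d ^ 2 / v) / df =
      (1 + q / df) * (1 + (d / s) ^ 2 / (df + k)) := by
    rw [div_pow, hs2]
    field_simp
    ring
  have hb1 : 0 < 1 + q / df := by positivity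
  have hb2 : 0 < 1 + (d / s) ^ 2 / (df + k) := by positivity
  rw [mvtPDF, mvtPDF, tPDF, quadForm_bordered hS, det_bordered hS, ← hq_def, ← hv_def, hbase,
    Real.mul_rpow hb1.le hb2.le]
  simp only [Fintype.card_sum, Fintype.card_unit, Fintype.card_fin, Nat.cast_add, Nat.cast_one]
  rw [show ((1 : ℝ) + k + df) / 2 = (df + k + 1) / 2 by ring, show (k + df : ℝ) = df + k by ring]
  rw [show (k + df : ℝ) = df + k by ring] at hG1
  have e1 : (1 + q / df) ^ (-((df + k + 1) / 2)) =
      (1 + q / df) ^ (-((df + k) / 2)) * (√(1 + q / df))⁻¹ := by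
    rw [Real.sqrt_eq_rpow, ← Real.rpow_neg hb1.le, ← Real.rpow_add hb1]
    congr 1
    ring
  have e2 : (Real.pi * df) ^ (((1 : ℝ) + k) / 2) =
      (Real.pi * df) ^ ((k : ℝ) / 2) * √(Real.pi * df) := by
    rw [Real.sqrt_eq_rpow, ← Real.rpow_add (by positivity)]
    congr 1
    ring
  -- The scale `s` accounts for the change of normalisation from `df` to `df + k`, for `√v` from the
  -- determinant, and for the half power of `1 + q / df` split off in `e1`.
  have e3 : √(Real.pi * (df + k)) * s = √(Real.pi * df) * √(1 + q / df) * √v := by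
    have h1 : √(Real.pi * (df + k)) * √((df + q) / (df + k)) =
        √(Real.pi * df) * √(1 + q / df) := by
      rw [← Real.sqrt_mul (by positivity), ← Real.sqrt_mul (by positivity)]
      congr 1
      field_simp
    rw [← h1, hs_def, condScale]
    ring
  rw [e1, e2, Real.sqrt_mul hR.le]
  have hp1 : 0 < √(Real.pi * df) := by positivity
  have hp2 : 0 < √(1 + q / df) := by positivity
  have hp3 : 0 < √v := by positivity
  have hp4 : 0 < √(Real.pi * (df + k)) := by positivity
  have hp5 : 0 < √R.det := by positivity
  have hp6 : 0 < (Real.pi * df) ^ ((k : ℝ) / 2) := by positivity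
  set A := (1 + q / df) ^ (-((df + k) / 2))
  set B := (1 + (d / s) ^ 2 / (df + k)) ^ (-((df + k + 1) / 2))
  clear_value A B v
  generalize Real.Gamma ((df + k + 1) / 2) = G3 at *
  generalize Real.Gamma ((df + k) / 2) = G1 at *
  generalize Real.Gamma (df / 2) = G2 at *
  generalize √(Real.pi * df) = p1 at *
  generalize √(1 + q / df) = p2 at *
  generalize √v = p3 at *
  generalize √(Real.pi * (df + k)) = p4 at *
  generalize √R.det = p5 at *
  generalize (Real.pi * df) ^ ((k : ℝ) / 2) = p6 at *
  calc G3 / (G2 * (p6 * p1) * (p5 * p3)) * (A * p2⁻¹ * B)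
      = G3 * A * B / (G2 * p6 * p5 * (p1 * p2 * p3)) := by field_simp
    _ = G3 * A * B / (G2 * p6 * p5 * (p4 * s)) := by rw [e3]
    _ = _ := by field_simp

/-- `Φ_ν((q - m) / s)` as an integral. -/
lemma setLIntegral_tPDF_affine {ν : ℝ} (hν : 0 < ν) (m : ℝ) {s : ℝ} (hs : 0 < s) (q : EReal) :
    ∫⁻ x in {x : ℝ | (x : EReal) ≤ q}, ENNReal.ofReal (s⁻¹ * tPDF ν ((x - m) / s)) =
      ENNReal.ofReal (tCDF ν ((q - (m : EReal)) / (s : EReal))) := by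
  have := isProbabilityMeasure_tMeasure hν
  have hmeas : ∀ q : EReal, MeasurableSet {x : ℝ | (x : EReal) ≤ q} := fun q =>
    measurableSet_le measurable_coe_real_ereal measurable_const
  have hiff : ∀ x : ℝ, (x : EReal) ≤ (q - (m : EReal)) / (s : EReal) ↔
      ((m + s * x : ℝ) : EReal) ≤ q := by
    intro x
    rw [EReal.le_div_iff_mul_le (by exact_mod_cast hs) (EReal.coe_ne_top _),
      EReal.le_sub_iff_add_le (by simp) (by simp)]
    norm_cast
    rw [mul_comm x s, add_comm]
  rw [tCDF, ofReal_measureReal, tMeasure, withDensity_apply _ (hmeas _),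
    ← lintegral_indicator (hmeas _), ← lintegral_indicator (hmeas _)]
  set g : ℝ → ENNReal := {x : ℝ | (x : EReal) ≤ q}.indicator
    fun x => ENNReal.ofReal (s⁻¹ * tPDF ν ((x - m) / s)) with hg
  have hgm : Measurable g := Measurable.indicator (by fun_prop) (hmeas _)
  -- Substitution `x ↦ m + s x`, with Jacobian `s` cancelling the factor `s⁻¹` of the density.
  have h1 : ∫⁻ x, g x = ENNReal.ofReal s * ∫⁻ x, g (m + s * x) := by
    rw [← lintegral_add_left_eq_self g m]
    have h2 := Real.smul_map_volume_mul_left hs.ne'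
    conv_lhs => rw [← h2]
    rw [lintegral_smul_measure, lintegral_map (by fun_prop) (by fun_prop), abs_of_pos hs, smul_eq_mul]
  rw [h1, ← lintegral_const_mul _ (by fun_prop)]
  refine lintegral_congr fun x => ?_
  by_cases hx : (x : EReal) ≤ (q - (m : EReal)) / (s : EReal)
  · rw [hg, indicator_of_mem (by exact (hiff x).1 hx), indicator_of_mem (by exact hx),
      ← ENNReal.ofReal_mul hs.le, mul_inv_cancel_left₀ hs.ne', add_sub_cancel_left,
      mul_div_cancel_left₀ _ hs.ne']
  · rw [hg, indicator_of_notMem (by exact fun h => hx ((hiff x).2 h)),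
      indicator_of_notMem (by exact hx), mul_zero]

/-- The mass of a lower orthant under a multivariate t-distribution, integrating out the first
coordinate. -/
lemma mvtMeasure_bordered_orthant {df : ℝ} (hdf : 0 < df) (hS : (bordered c R).PosDef)
    (q : Unit ⊕ Fin k → EReal) :
    mvtMeasure df (bordered c R) {x | ∀ i, (x i : EReal) ≤ q i} =
      ∫⁻ y in {y : Fin k → ℝ | ∀ i, (y i : EReal) ≤ q (Sum.inr i)},
        ENNReal.ofReal (tCDF (df + k)
          ((q (Sum.inl ()) - (condLoc c R y : EReal)) / (condScale df c R y : EReal))) *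
          ENNReal.ofReal (mvtPDF df R y) := by
  have hA : MeasurableSet {x : Unit ⊕ Fin k → ℝ | ∀ i, (x i : EReal) ≤ q i} := by
    rw [ofPred_forall]
    exact MeasurableSet.iInter fun i => measurableSet_le (by fun_prop) (by fun_prop)
  have hB : MeasurableSet {y : Fin k → ℝ | ∀ i, (y i : EReal) ≤ q (Sum.inr i)} := by
    rw [ofPred_forall]
    exact MeasurableSet.iInter fun i => measurableSet_le (by fun_prop) (by fun_prop)
  have hC : MeasurableSet {x : ℝ | (x : EReal) ≤ q (Sum.inl ())} :=
    measurableSet_le (by fun_prop) (by fun_prop)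
  set e : ℝ × (Fin k → ℝ) → Unit ⊕ Fin k → ℝ := fun p => Sum.elim (fun _ => p.1) p.2 with he
  have hmp : MeasurePreserving e (volume.prod volume) volume := by
    have h1 := (volume_measurePreserving_sumPiEquivProdPi_symm (fun _ : Unit ⊕ Fin k => ℝ))
    have h2 := (volume_preserving_funUnique Unit ℝ).symm
    have h3 := h1.comp (h2.prod (MeasurePreserving.id (volume : Measure (Fin k → ℝ))))
    convert h3 using 1
    ext p i
    cases i <;> rfl
  set g : (Unit ⊕ Fin k → ℝ) → ENNReal := {x : Unit ⊕ Fin k → ℝ | ∀ i, (x i : EReal) ≤ q i}.indicator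
    fun x => ENNReal.ofReal (mvtPDF df (bordered c R) x) with hg
  have hgm : Measurable g := Measurable.indicator (by fun_prop) hA
  rw [mvtMeasure, withDensity_apply _ hA, ← lintegral_indicator hA, ← hg,
    ← hmp.lintegral_comp hgm, lintegral_prod_symm (fun p => g (e p)) (hgm.comp hmp.measurable).aemeasurable,
    ← lintegral_indicator hB]
  refine lintegral_congr fun y => ?_
  by_cases hy : y ∈ {y : Fin k → ℝ | ∀ i, (y i : EReal) ≤ q (Sum.inr i)}
  · rw [indicator_of_mem hy, ← setLIntegral_tPDF_affine (by positivity) _ (condScale_pos hdf hS y),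
      ← lintegral_mul_const _ (by fun_prop), ← lintegral_indicator hC]
    refine lintegral_congr fun x => ?_
    have hiff : e (x, y) ∈ {x : Unit ⊕ Fin k → ℝ | ∀ i, (x i : EReal) ≤ q i} ↔
        x ∈ {x : ℝ | (x : EReal) ≤ q (Sum.inl ())} := by
      constructor
      · exact fun h => h (Sum.inl ())
      · rintro h (i | i)
        · exact h
        · exact hy i
    by_cases hx : x ∈ {x : ℝ | (x : EReal) ≤ q (Sum.inl ())}
    · rw [hg, indicator_of_mem (hiff.2 hx), indicator_of_mem hx, he, mvtPDF_bordered hdf hS,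
        ENNReal.ofReal_mul (mvtPDF_pos hdf (posDef_of_bordered hS) y).le, mul_comm]
    · rw [hg, indicator_of_notMem (fun h => hx (hiff.1 h)), indicator_of_notMem hx]
  · rw [indicator_of_notMem hy]
    refine (lintegral_congr fun x => ?_).trans lintegral_zero
    rw [hg, indicator_of_notMem]
    exact fun h => hy fun i => h (Sum.inr i)

end Block

/-! ### Positive definiteness under equicorrelation -/

lemma posDef_fullCorr_equi {k : ℕ} {ρ₁ ρ₂ : ℝ} (h : ρ₁ ^ 2 < ρ₂) (hρ₂ : ρ₂ < 1) :
    (fullCorr .equi k ρ₁ ρ₂).PosDef := by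
  refine PosDef.of_dotProduct_mulVec_pos ?_ fun x hx => ?_
  · refine IsHermitian.fromBlocks isHermitian_one ?_ ?_
    · ext i j; simp
    · ext i j
      simp [sevCorr, eq_comm]
  · set a := x (Sum.inl ()) with ha
    set s := ∑ i, x (Sum.inr i) with hs
    -- Completing the square in the frequency coordinate `a` leaves `(ρ₂ - ρ₁²) s²`, which is where
    -- `ρ₁² < ρ₂` enters.
    have hform : star x ⬝ᵥ (fullCorr .equi k ρ₁ ρ₂ *ᵥ x) =
        (a + ρ₁ * s) ^ 2 + (ρ₂ - ρ₁ ^ 2) * s ^ 2 + (1 - ρ₂) * ∑ i, x (Sum.inr i) ^ 2 := by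
      have h0 : fullCorr .equi k ρ₁ ρ₂ *ᵥ x =
          Sum.elim (fun _ => a + ρ₁ * s)
            (fun i => ρ₁ * a + ((1 - ρ₂) * x (Sum.inr i) + ρ₂ * s)) := by
        rw [fullCorr, fromBlocks_mulVec]
        congr 1
        · ext i
          simp [mulVec, dotProduct, crossCorr, ← Finset.mul_sum, a, s]
        · ext i
          have h1 : ∀ j, (if i = j then 1 else ρ₂) * x (Sum.inr j) =
              (if i = j then (1 - ρ₂) * x (Sum.inr j) else 0) + ρ₂ * x (Sum.inr j) := by
            intro j; split_ifs <;> ring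
          simp [mulVec, dotProduct, crossCorr, sevCorr, h1, Finset.sum_add_distrib,
            ← Finset.mul_sum, a, s]
      rw [h0]
      simp only [dotProduct, star_trivial, Fintype.sum_sum_type, Finset.univ_unique,
        Finset.sum_singleton, Sum.elim_inl, Sum.elim_inr, mul_add, Finset.sum_add_distrib]
      have h2 : ∑ i, x (Sum.inr i) * ((1 - ρ₂) * x (Sum.inr i)) =
          (1 - ρ₂) * ∑ i, x (Sum.inr i) ^ 2 := by
        rw [Finset.mul_sum]; exact Finset.sum_congr rfl fun i _ => by ring
      rw [h2, ← Finset.sum_mul, ← Finset.sum_mul, ← hs]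
      change a * a + a * (ρ₁ * s) + _ = _
      ring
    rw [hform]
    have hsum : 0 ≤ ∑ i, x (Sum.inr i) ^ 2 := Finset.sum_nonneg fun i _ => sq_nonneg _
    have h1 : 0 < 1 - ρ₂ := by linarith
    have h2 : 0 < ρ₂ - ρ₁ ^ 2 := by linarith
    rcases hsum.eq_or_lt with h0 | h0
    · have hz : ∀ i, x (Sum.inr i) = 0 := fun i => by
        have := (Finset.sum_eq_zero_iff_of_nonneg fun i _ => sq_nonneg _).1 h0.symm i
          (Finset.mem_univ i)
        exact pow_eq_zero_iff two_ne_zero |>.1 this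
      have ha0 : a ≠ 0 := fun h => hx <| by
        ext (i | i)
        · exact h
        · exact hz i
      have hs0 : s = 0 := by simp [hs, hz]
      rw [hs0, ← h0]
      have := sq_pos_of_ne_zero ha0
      simpa using this
    · positivity

/-! ### Measures determined by lower orthants -/

/-- A finite measure on `ℝᵏ` is determined by its values on lower orthants. -/
lemma measure_ext_of_Iic {k : ℕ} {μ ν : Measure (Fin k → ℝ)} [IsFiniteMeasure μ]
    (h : ∀ y, μ (Iic y) = ν (Iic y)) : μ = ν := by
  have hgen := generateFrom_eq_pi (ι := Fin k) (α := fun _ => ℝ)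
    (C := fun _ => range (Iic : ℝ → Set ℝ))
    (fun _ => by rw [BorelSpace.measurable_eq (α := ℝ), borel_eq_generateFrom_Iic])
    (fun _ => ⟨fun n : ℕ => Iic (n : ℝ), fun n => mem_range_self _, by
      refine eq_univ_of_forall fun x => ?_
      obtain ⟨n, hn⟩ := exists_nat_ge x
      exact mem_iUnion.2 ⟨n, hn⟩⟩)
  refine Measure.ext_of_generateFrom_of_iUnion _ (fun n : ℕ => Iic fun _ => (n : ℝ)) hgen.symm
    (IsPiSystem.pi fun _ => ?_) ?_ (fun n => ?_) (fun n => measure_ne_top _ _) ?_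
  · rintro _ ⟨a, rfl⟩ _ ⟨b, rfl⟩ -
    exact ⟨a ⊓ b, Iic_inter_Iic.symm⟩
  · refine eq_univ_of_forall fun x => ?_
    obtain ⟨n, hn⟩ := exists_nat_ge ‖x‖
    exact mem_iUnion.2 ⟨n, fun i => (le_abs_self _).trans ((norm_le_pi_norm x i).trans hn)⟩
  · exact ⟨fun _ => Iic (n : ℝ), fun _ _ => mem_range_self _, pi_univ_Iic _⟩
  · rintro _ ⟨t, ht, rfl⟩
    choose a ha using fun i => ht i (mem_univ i)
    obtain rfl : (fun i => Iic (a i)) = t := funext ha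
    rw [pi_univ_Iic]
    exact h a

lemma hasDensity_of_Iic {k : ℕ} {ν : Measure (Fin k → ℝ)} [IsFiniteMeasure ν]
    {g : (Fin k → ℝ) → ℝ} (hg : Measurable g) (hg0 : ∀ y, 0 ≤ g y)
    (h : ∀ y, ν (Iic y) = ∫⁻ t in Iic y, ENNReal.ofReal (g t)) : HasDensity ν g :=
  ⟨hg, hg0, measure_ext_of_Iic fun y => by rw [h, withDensity_apply _ measurableSet_Iic]⟩

/-! ### Student probabilities at rescaled quantiles -/

section AffineQuantile

/-- For infinite `q` the argument is constant because the scale is positive and finite; for real `q`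
the arithmetic is that of `ℝ`. -/
lemma measurable_tCDF_sub_div {α : Type*} [MeasurableSpace α] {ν : ℝ} (hν : 0 < ν) (q : EReal)
    {m s : α → ℝ} (hm : Measurable m) (hs : Measurable s) (hs0 : ∀ y, 0 < s y) :
    Measurable fun y => tCDF ν ((q - (m y : EReal)) / (s y : EReal)) := by
  refine (tCDF_mono hν).measurable.comp ?_
  induction q with
  | bot => simp [EReal.bot_div_of_pos_ne_top, hs0]
  | top => simp [EReal.top_div_of_pos_ne_top, hs0]
  | coe q =>
    simp_rw [← EReal.coe_sub, ← EReal.coe_div]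
    exact ((measurable_const.sub hm).div hs).coe_real_ereal

lemma tCDF_sub_div_mono {ν : ℝ} (hν : 0 < ν) {q q' : EReal} (hq : q ≤ q') (m : ℝ) {s : ℝ}
    (hs : 0 < s) :
    tCDF ν ((q - (m : EReal)) / (s : EReal)) ≤ tCDF ν ((q' - (m : EReal)) / (s : EReal)) :=
  tCDF_mono hν (EReal.div_le_div_right_of_nonneg (by exact_mod_cast hs.le)
    (EReal.sub_le_sub hq le_rfl))

lemma tendsto_tCDF_sub_div {ν df : ℝ} (hν : 0 < ν) (hdf : 0 < df) (m : ℝ) {s : ℝ} (hs : 0 < s)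
    {u : ℕ → ℝ} (hu : Tendsto u atTop (𝓝 1)) (hu0 : ∀ n, u n ∈ Icc (0 : ℝ) 1) :
    Tendsto (fun n => tCDF ν ((tQuantile df (u n) - (m : EReal)) / (s : EReal))) atTop (𝓝 1) := by
  have := isProbabilityMeasure_tMeasure hν
  refine tendsto_order.2 ⟨fun a ha => ?_, fun a ha =>
    Eventually.of_forall fun n => (tCDF_le_one hν _).trans_lt ha⟩
  obtain ⟨r, hr⟩ := ((tendsto_cdf_atTop (tMeasure ν)).eventually_const_lt ha).exists
  rw [← tCDF_coe hν] at hr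
  -- Once `u n` exceeds this level, its quantile is at least `m + s * r`, so the rescaled argument
  -- is at least `r`.
  have hlt : tCDF df ((m + s * r : ℝ) : EReal) < 1 :=
    tCDF_top hdf ▸ tCDF_strictMono hdf (EReal.coe_lt_top _)
  filter_upwards [hu.eventually_const_lt hlt] with n hn
  refine hr.trans_le (tCDF_mono hν ?_)
  have h := (le_tQuantile_iff hdf (hu0 n) _).2 hn.le
  rw [EReal.le_div_iff_mul_le (by exact_mod_cast hs) (EReal.coe_ne_top _),
    EReal.le_sub_iff_add_le (by simp) (by simp)]
  convert h using 1
  norm_cast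
  ring

end AffineQuantile

lemma posDef_fullCorr {z : CorrKind} {k : ℕ} {ρ₁ ρ₂ : ℝ} (hρ₂ : ρ₂ < 1)
    (hequi : z = .equi → ρ₁ ^ 2 < ρ₂)
    (hautoreg : z = .autoreg → (fullCorr z k ρ₁ ρ₂).PosDef) :
    (fullCorr z k ρ₁ ρ₂).PosDef := by
  cases z with
  | equi => exact posDef_fullCorr_equi (hequi rfl) hρ₂
  | autoreg => exact hautoreg rfl

/-! ### Densities in the copula model -/

section Model

variable {Ω : Type*} [MeasurableSpace Ω] {P : Measure Ω} [IsProbabilityMeasure P]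
  {z : CorrKind} {k : ℕ} {df ρ₁ ρ₂ : ℝ} {ν₂ : Measure ℝ}
  {f₂ : ℝ → ℝ} {N : Ω → ℕ} {Y : Ω → Fin k → ℝ}

lemma condFreqCDF_nonneg (u : ℝ) (y : Fin k → ℝ) : 0 ≤ condFreqCDF z k df ρ₁ ρ₂ ν₂ u y :=
  tCDF_nonneg _ _

lemma measurable_condFreqCDF (hdf : 0 < df) (hS : (fullCorr z k ρ₁ ρ₂).PosDef) (u : ℝ) :
    Measurable (condFreqCDF z k df ρ₁ ρ₂ ν₂ u) :=
  measurable_tCDF_sub_div (by positivity) _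
    ((measurable_condLoc (crossCorr k ρ₁) (sevCorr z k ρ₂)).comp (measurable_scores df ν₂))
    ((measurable_condScale df (crossCorr k ρ₁) (sevCorr z k ρ₂)).comp (measurable_scores df ν₂))
    (fun _ => condScale_pos hdf hS _)

lemma condFreqCDF_mono (hdf : 0 < df) (hS : (fullCorr z k ρ₁ ρ₂).PosDef) {u v : ℝ} (h : u ≤ v)
    (y : Fin k → ℝ) :
    condFreqCDF z k df ρ₁ ρ₂ ν₂ u y ≤ condFreqCDF z k df ρ₁ ρ₂ ν₂ v y :=
  tCDF_sub_div_mono (by positivity) (tQuantile_mono df h) _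
    (condScale_pos (c := crossCorr k ρ₁) (R := sevCorr z k ρ₂) hdf hS _)

lemma tendsto_condFreqCDF (hdf : 0 < df) (hS : (fullCorr z k ρ₁ ρ₂).PosDef) {u : ℕ → ℝ}
    (hu : Tendsto u atTop (𝓝 1)) (hu0 : ∀ n, u n ∈ Icc (0 : ℝ) 1) (y : Fin k → ℝ) :
    Tendsto (fun n => condFreqCDF z k df ρ₁ ρ₂ ν₂ (u n) y) atTop (𝓝 1) :=
  tendsto_tCDF_sub_div (by positivity) hdf _
    (condScale_pos (c := crossCorr k ρ₁) (R := sevCorr z k ρ₂) hdf hS _) hu hu0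

lemma measurable_fStar (hf₂ : HasDensity ν₂ f₂) : Measurable (fStar z k df ρ₂ ν₂ f₂) := by
  have hf : Measurable f₂ := hf₂.1
  unfold fStar
  fun_prop

lemma fStar_nonneg (hdf : 0 < df) (hS : (fullCorr z k ρ₁ ρ₂).PosDef) (hf₂ : HasDensity ν₂ f₂)
    (y : Fin k → ℝ) : 0 ≤ fStar z k df ρ₂ ν₂ f₂ y :=
  mul_nonneg
    (div_nonneg (mvtPDF_pos hdf (posDef_of_bordered (c := crossCorr k ρ₁) hS) _).le
      (Finset.prod_nonneg fun _ _ => (tPDF_pos hdf _).le))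
    (Finset.prod_nonneg fun _ _ => hf₂.2.1 _)

variable [IsProbabilityMeasure ν₂]

lemma freqCDF_mem_Icc (s : ℝ) : freqCDF P N s ∈ Icc (0 : ℝ) 1 :=
  ⟨measureReal_nonneg, measureReal_le_one⟩

lemma freqCDF_mono : Monotone (freqCDF P N) :=
  fun _ _ h => measureReal_mono fun _ hω => le_trans hω h

lemma tendsto_measure_freq_le_inter (P : Measure Ω) (N : Ω → ℕ) (A : Set Ω) :
    Tendsto (fun n : ℕ => P {ω | (N ω : ℝ) ≤ (n : ℝ) ∧ ω ∈ A}) atTop (𝓝 (P A)) := by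
  have hmono : Monotone fun n : ℕ => {ω | (N ω : ℝ) ≤ (n : ℝ) ∧ ω ∈ A} :=
    fun a b hab ω hω => ⟨hω.1.trans (by exact_mod_cast hab), hω.2⟩
  have hU : ⋃ n : ℕ, {ω | (N ω : ℝ) ≤ (n : ℝ) ∧ ω ∈ A} = A := by
    ext ω
    simp only [mem_iUnion, mem_ofPred_eq]
    exact ⟨fun ⟨_, h⟩ => h.2, fun h => ⟨N ω, le_rfl, h⟩⟩
  have h := tendsto_measure_iUnion_atTop (μ := P) hmono
  rw [hU] at h
  exact h

lemma tendsto_freqCDF_nat : Tendsto (fun n : ℕ => freqCDF P N n) atTop (𝓝 1) := by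
  have h := tendsto_measure_freq_le_inter P N univ
  rw [measure_univ] at h
  simpa [freqCDF, measureReal_def, Function.comp_def] using
    (ENNReal.tendsto_toReal ENNReal.one_ne_top).comp h

/-- Integral form of the joint distribution function. -/
lemma IsTCopulaModel.measure_joint (hdf : 0 < df) (hS : (fullCorr z k ρ₁ ρ₂).PosDef)
    (hf₂ : HasDensity ν₂ f₂) (hmodel : IsTCopulaModel P z k df ρ₁ ρ₂ ν₂ N Y) (s : ℝ)
    (y : Fin k → ℝ) :
    P {ω | (N ω : ℝ) ≤ s ∧ ∀ i, Y ω i ≤ y i} =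
      ∫⁻ t in Iic y, ENNReal.ofReal (condFreqCDF z k df ρ₁ ρ₂ ν₂ (freqCDF P N s) t) *
        ENNReal.ofReal (fStar z k df ρ₂ ν₂ f₂ t) := by
  have := isFiniteMeasure_mvtMeasure hdf hS
  have h := hmodel.joint_cdf s y
  rw [tCopula, measureReal_def, measureReal_def,
    ENNReal.toReal_eq_toReal_iff' (measure_ne_top _ _) (measure_ne_top _ _)] at h
  rw [h]
  refine (mvtMeasure_bordered_orthant hdf hS _).trans ?_
  exact setLIntegral_mvtPDF_eq hdf hf₂ (sevCorr z k ρ₂)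
    (measurable_tCDF_sub_div (by positivity) (tQuantile df (freqCDF P N s))
      (measurable_condLoc _ _) (measurable_condScale _ _ _)
      fun y => condScale_pos hdf hS y).ennreal_ofReal y

/-- Integral form of the distribution function of the severities. -/
lemma IsTCopulaModel.measure_sev (hdf : 0 < df) (hS : (fullCorr z k ρ₁ ρ₂).PosDef)
    (hf₂ : HasDensity ν₂ f₂) (hmodel : IsTCopulaModel P z k df ρ₁ ρ₂ ν₂ N Y)
    (y : Fin k → ℝ) :
    P {ω | ∀ i, Y ω i ≤ y i} = ∫⁻ t in Iic y, ENNReal.ofReal (fStar z k df ρ₂ ν₂ f₂ t) := by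
  have h1 := tendsto_measure_freq_le_inter P N {ω | ∀ i, Y ω i ≤ y i}
  simp only [mem_ofPred_eq, hmodel.measure_joint hdf hS hf₂] at h1
  -- Monotone convergence: as `n → ∞`, `F₁⁺(n)` increases to `1` and the conditional factor to `1`.
  refine tendsto_nhds_unique h1 (lintegral_tendsto_of_tendsto_of_monotone (fun n => ?_) ?_ ?_)
  · exact ((measurable_condFreqCDF hdf hS _).ennreal_ofReal.mul
      (measurable_fStar hf₂).ennreal_ofReal).aemeasurable
  · refine ae_of_all _ fun t a b hab => ?_
    have := condFreqCDF_mono (ν₂ := ν₂) hdf hS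
      (freqCDF_mono (P := P) (N := N) (Nat.cast_le (α := ℝ).2 hab)) t
    dsimp only
    gcongr
  · refine ae_of_all _ fun t => ?_
    have h2 := (ENNReal.continuous_ofReal.tendsto 1).comp
      (tendsto_condFreqCDF (ν₂ := ν₂) hdf hS (tendsto_freqCDF_nat (P := P) (N := N))
        (fun n => freqCDF_mem_Icc _) t)
    rw [ENNReal.ofReal_one] at h2
    simpa using ENNReal.Tendsto.mul_const h2 (Or.inl one_ne_zero)

lemma measure_mvt_orthant_eq (hdf : 0 < df) (hf₂ : HasDensity ν₂ f₂) (y : Fin k → ℝ) :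
    mvtMeasure df (sevCorr z k ρ₂) {x | ∀ i, (x i : EReal) ≤ tQuantile df (cdf ν₂ (y i))} =
      ∫⁻ t in Iic y, ENNReal.ofReal (fStar z k df ρ₂ ν₂ f₂ t) := by
  have hA : MeasurableSet {x : Fin k → ℝ | ∀ i, (x i : EReal) ≤ tQuantile df (cdf ν₂ (y i))} := by
    rw [ofPred_forall]
    exact MeasurableSet.iInter fun i => measurableSet_le (by fun_prop) (by fun_prop)
  rw [mvtMeasure, withDensity_apply _ hA]
  simpa only [Pi.one_apply, one_mul, fStar] using
    setLIntegral_mvtPDF_eq hdf hf₂ (sevCorr z k ρ₂) (H := 1) measurable_one y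

/-- On the event that the frequency is `n`, the severities have a density given by the increment at
`n` of the conditional distribution function of the frequency. -/
lemma IsTCopulaModel.hasDensity_restrict (hdf : 0 < df) (hS : (fullCorr z k ρ₁ ρ₂).PosDef)
    (hf₂ : HasDensity ν₂ f₂) (hmodel : IsTCopulaModel P z k df ρ₁ ρ₂ ν₂ N Y) (n : ℕ) :
    HasDensity ((P.restrict {ω | N ω = n}).map Y) fun y =>
      fStar z k df ρ₂ ν₂ f₂ y *
        (condFreqCDF z k df ρ₁ ρ₂ ν₂ (freqCDF P N n) y -
          condFreqCDF z k df ρ₁ ρ₂ ν₂ (freqCDF P N ((n : ℝ) - 1)) y) := by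
  have hle : ∀ y : Fin k → ℝ, condFreqCDF z k df ρ₁ ρ₂ ν₂ (freqCDF P N ((n : ℝ) - 1)) y ≤
      condFreqCDF z k df ρ₁ ρ₂ ν₂ (freqCDF P N n) y := fun y =>
    condFreqCDF_mono hdf hS (freqCDF_mono (by linarith)) y
  have hf0 := fStar_nonneg hdf hS hf₂
  have hN : MeasurableSet {ω | N ω = n} := hmodel.measurable_freq (measurableSet_singleton n)
  have hmeas : Measurable fun y =>
      fStar z k df ρ₂ ν₂ f₂ y *
        (condFreqCDF z k df ρ₁ ρ₂ ν₂ (freqCDF P N n) y -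
          condFreqCDF z k df ρ₁ ρ₂ ν₂ (freqCDF P N ((n : ℝ) - 1)) y) :=
    (measurable_fStar hf₂).mul
      ((measurable_condFreqCDF hdf hS _).sub (measurable_condFreqCDF hdf hS _))
  refine hasDensity_of_Iic hmeas (fun y => mul_nonneg (hf0 y) (sub_nonneg.2 (hle y))) fun y => ?_
  have hY : MeasurableSet (Y ⁻¹' Iic y) := hmodel.measurable_sev measurableSet_Iic
  rw [Measure.map_apply hmodel.measurable_sev measurableSet_Iic, Measure.restrict_apply hY]
  -- Integrality of `N` makes `N ≤ n - 1` the same as `N < n`. The subtraction is real, so nothing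
  -- is truncated at `n = 0`.
  have hsplit : {ω | (N ω : ℝ) ≤ (n : ℝ) ∧ ∀ i, Y ω i ≤ y i} =
      {ω | (N ω : ℝ) ≤ (n : ℝ) - 1 ∧ ∀ i, Y ω i ≤ y i} ∪ (Y ⁻¹' Iic y ∩ {ω | N ω = n}) := by
    ext ω
    have h1 : (N ω : ℝ) ≤ (n : ℝ) - 1 ↔ N ω < n := by
      rw [le_sub_iff_add_le]
      exact_mod_cast Nat.succ_le_iff
    have h2 : (N ω : ℝ) ≤ (n : ℝ) ↔ N ω < n ∨ N ω = n := by
      rw [Nat.cast_le, le_iff_lt_or_eq]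
    simp only [mem_ofPred_eq, mem_union, mem_inter_iff, mem_preimage, mem_Iic, Pi.le_def, h1, h2]
    tauto
  have hdisj : Disjoint {ω | (N ω : ℝ) ≤ (n : ℝ) - 1 ∧ ∀ i, Y ω i ≤ y i}
      (Y ⁻¹' Iic y ∩ {ω | N ω = n}) := by
    refine disjoint_left.2 fun ω h1 h2 => ?_
    have h3 : (N ω : ℝ) = n := congrArg _ h2.2
    linarith [h1.1]
  have hj := hmodel.measure_joint hdf hS hf₂ n y
  have hj' := hmodel.measure_joint hdf hS hf₂ ((n : ℝ) - 1) y
  rw [hsplit, measure_union hdisj (hY.inter hN)] at hj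
  -- Adding the finite mass of `{N ≤ n - 1, Y ≤ y}` to both sides avoids subtraction in `ENNReal`.
  refine (ENNReal.add_right_inj (measure_ne_top P
    {ω | (N ω : ℝ) ≤ (n : ℝ) - 1 ∧ ∀ i, Y ω i ≤ y i})).1 ?_
  rw [hj, hj', ← lintegral_add_right _ hmeas.ennreal_ofReal]
  refine lintegral_congr fun t => ?_
  rw [← ENNReal.ofReal_mul (condFreqCDF_nonneg _ _), ← ENNReal.ofReal_mul (condFreqCDF_nonneg _ _),
    ← ENNReal.ofReal_add (mul_nonneg (condFreqCDF_nonneg _ _) (hf0 t))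
      (mul_nonneg (hf0 t) (sub_nonneg.2 (hle t)))]
  congr 1
  ring

end Model

end CollectiveRisk

theorem lemma2 {Ω : Type*} [MeasurableSpace Ω] (P : Measure Ω) [IsProbabilityMeasure P]
    (z : CollectiveRisk.CorrKind) (k : ℕ) (hk : 0 < k)
    (df : ℝ) (hdf : 0 < df)
    (ρ₁ ρ₂ : ℝ) (hρ₁ : ρ₁ ∈ Set.Ioo (-1 : ℝ) 1) (hρ₂ : ρ₂ ∈ Set.Ioo (-1 : ℝ) 1)
    (hequi : z = CollectiveRisk.CorrKind.equi → ρ₁ ^ 2 < ρ₂)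
    (hautoreg : z = CollectiveRisk.CorrKind.autoreg →
      (CollectiveRisk.fullCorr z k ρ₁ ρ₂).PosDef)
    (ν₂ : Measure ℝ) [IsProbabilityMeasure ν₂] (hν₂ : ν₂ (Set.Iio 0) = 0)
    (f₂ : ℝ → ℝ) (hf₂ : CollectiveRisk.HasDensity ν₂ f₂)
    (N : Ω → ℕ) (Y : Ω → Fin k → ℝ)
    (hmodel : CollectiveRisk.IsTCopulaModel P z k df ρ₁ ρ₂ ν₂ N Y) :
    -- the joint density of `(N, Y)`
    (∀ n : ℕ, 1 ≤ n →
      CollectiveRisk.HasDensity ((P.restrict {ω | N ω = n}).map Y) (fun y =>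
        CollectiveRisk.fStar z k df ρ₂ ν₂ f₂ y *
          (CollectiveRisk.condFreqCDF z k df ρ₁ ρ₂ ν₂ (CollectiveRisk.freqCDF P N n) y -
            CollectiveRisk.condFreqCDF z k df ρ₁ ρ₂ ν₂
              (CollectiveRisk.freqCDF P N ((n : ℝ) - 1)) y))) ∧
    -- `Y` has distribution function `C(F₂, …, F₂)` and density `f*`
    (∀ y : Fin k → ℝ,
      P.real {ω | ∀ i, Y ω i ≤ y i} =
        CollectiveRisk.tCopula df (CollectiveRisk.sevCorr z k ρ₂) (fun i => cdf ν₂ (y i))) ∧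
    CollectiveRisk.HasDensity (P.map Y) (CollectiveRisk.fStar z k df ρ₂ ν₂ f₂) ∧
    -- the conditional density of `Y` given `N = n`
    (∀ n : ℕ, 1 ≤ n → P {ω | N ω = n} ≠ 0 →
      CollectiveRisk.HasDensity ((P[|{ω | N ω = n}]).map Y) (fun y =>
        CollectiveRisk.fStar z k df ρ₂ ν₂ f₂ y / CollectiveRisk.freqPMF P N n *
          (CollectiveRisk.condFreqCDF z k df ρ₁ ρ₂ ν₂ (CollectiveRisk.freqCDF P N n) y -
            CollectiveRisk.condFreqCDF z k df ρ₁ ρ₂ ν₂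
              (CollectiveRisk.freqCDF P N ((n : ℝ) - 1)) y))) := by
  have hS := CollectiveRisk.posDef_fullCorr hρ₂.2 hequi hautoreg
  refine ⟨fun n _ => hmodel.hasDensity_restrict hdf hS hf₂ n, fun y => ?_, ?_, fun n _ hn => ?_⟩
  · rw [CollectiveRisk.tCopula, measureReal_def, measureReal_def,
      hmodel.measure_sev hdf hS hf₂, CollectiveRisk.measure_mvt_orthant_eq hdf hf₂]
  · have := Measure.isProbabilityMeasure_map (μ := P) hmodel.measurable_sev.aemeasurable
    refine CollectiveRisk.hasDensity_of_Iic (CollectiveRisk.measurable_fStar hf₂)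
      (CollectiveRisk.fStar_nonneg hdf hS hf₂) fun y => ?_
    rw [Measure.map_apply hmodel.measurable_sev measurableSet_Iic]
    exact hmodel.measure_sev hdf hS hf₂ y
  · obtain ⟨hm, h0, heq⟩ := hmodel.hasDensity_restrict hdf hS hf₂ n
    have hp : 0 < CollectiveRisk.freqPMF P N n :=
      ENNReal.toReal_pos hn (measure_ne_top _ _)
    have hform : ∀ a b : ℝ, a / CollectiveRisk.freqPMF P N n * b =
        (CollectiveRisk.freqPMF P N n)⁻¹ * (a * b) := fun a b => by ring
    simp only [hform]
    refine ⟨hm.const_mul _, fun y => mul_nonneg (inv_nonneg.2 hp.le) (h0 y), ?_⟩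
    have hinv : (P {ω | N ω = n})⁻¹ = ENNReal.ofReal (CollectiveRisk.freqPMF P N n)⁻¹ := by
      rw [ENNReal.ofReal_inv_of_pos hp, CollectiveRisk.freqPMF, ofReal_measureReal]
    -- Conditioning is restriction scaled by the inverse mass, so the restricted density is scaled
    -- by `1 / f₁⁺(n)`.
    rw [ProbabilityTheory.cond, Measure.map_smul, heq, hinv,
      ← withDensity_smul _ hm.ennreal_ofReal]
    congr 1
    ext y
    rw [Pi.smul_apply, smul_eq_mul, ← ENNReal.ofReal_mul (inv_nonneg.2 hp.le)]
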